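/- There exist a real-valued function $f\in C^2(\mathbb R)$ with bounded second derivative, a sequence $(\mathcal H_n)_{n}$ of finite-dimensional complex Hilbert spaces, and self-adjoint operators $A_n, B_n\in B(\mathcal H_n)$ such that the following holds. Let $\mathcal H=\bigoplus_n^{2}\mathcal H_n$ be the Hilbertian direct sum. 1. The direct sum $A=\bigoplus_n A_n$, defined by $A\xi=(A_n\xi_n)_n$ on the domain $\{\xi=(\xi_n)_n\in\mathcal H : \sum_n\|A_n\xi_n\|^2<\infty\}$, is an unbounded self-adjoint operator on $\mathcal H$. 2. The direct sum $B=\bigoplus_n B_n$ is a bounded self-adjoint operator on $\mathcal H$ in the Hilbert–Schmidt class $\mathcal S^2(\mathcal H)$. 3. For every $n$ the map $t\mapsto f(A_n+tB_n)$ is differentiable at $t=0$, and the operator $$f(A+B)-f(A)-\frac{d}{dt}\Big(f(A+tB)\Big)\Big|_{t=0}:=\bigoplus_{n}\Big(f(A_n+B_n)-f(A_n)-\frac{d}{dt}\Big(f(A_n+tB_n)\Big)\Big|_{t=0}\Big)$$ is a bounded operator on $\mathcal H$ that belongs to $\mathcal S^2(\mathcal H)$ but does not belong to the trace class $\mathcal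 S^1(\mathcal H)$. In particular, the answer to the following question of Peller is negative: if $f$ is a $C^2$ function with bounded second derivative, $A$ a self-adjoint (possibly unbounded) operator and $B\in\mathcal S^2$ self-adjoint, is $f(A+B)-f(A)-\frac{d}{dt}(f(A+tB))|_{t=0}$ always in $\mathcal S^1$? -/

import Mathlib

open scoped ENNReal

noncomputable section

/-- The Hilbertian direct sum of a sequence of Hilbert spaces. -/
abbrev HilbertSum (G : ℕ → Type*) [∀ n, NormedAddCommGroup (G n)]
    [∀ n, InnerProductSpace ℂ (G n)] : Type _ :=
  lp G 2

/-- The (possibly unbounded) direct sum `⊕ Aₙ` of a sequence of bounded operators, with domain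
the set of all `ξ` in the Hilbertian direct sum such that `∑ ‖Aₙ ξₙ‖² < ∞`. -/
def directSumOp {G : ℕ → Type*} [∀ n, NormedAddCommGroup (G n)]
    [∀ n, InnerProductSpace ℂ (G n)] (A : ∀ n, G n →L[ℂ] G n) :
    HilbertSum G →ₗ.[ℂ] HilbertSum G where
  domain :=
    { carrier := {ξ | Memℓp (fun n => A n (ξ n)) 2}
      add_mem' := by
        intro ξ η hξ hη
        have h : (fun n => A n ((ξ + η : HilbertSum G) n)) =
            (fun n => A n (ξ n)) + fun n => A n (η n) := by
          funext n
          simp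
        rw [Set.mem_ofPred_eq, h]
        exact Memℓp.add hξ hη
      zero_mem' := by
        have h : (fun n => A n ((0 : HilbertSum G) n)) = 0 := by
          funext n
          simp
        rw [Set.mem_ofPred_eq, h]
        exact zero_memℓp
      smul_mem' := by
        intro c ξ hξ
        have h : (fun n => A n ((c • ξ : HilbertSum G) n)) = c • fun n => A n (ξ n) := by
          funext n
          simp
        rw [Set.mem_ofPred_eq, h]
        exact Memℓp.const_smul hξ c }
  toFun :=
    { toFun := fun ξ => ⟨fun n => A n ((ξ : HilbertSum G) n), ξ.2⟩
      map_add' := by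
        intro ξ η
        ext n
        exact map_add (A n) _ _
      map_smul' := by
        intro c ξ
        ext n
        exact map_smul (A n) c _ }

/-- The bounded operator `T` on the Hilbertian direct sum is the direct sum of the operators
`Tₙ`. -/
def IsDirectSum {G : ℕ → Type*} [∀ n, NormedAddCommGroup (G n)]
    [∀ n, InnerProductSpace ℂ (G n)] (T : HilbertSum G →L[ℂ] HilbertSum G)
    (S : ∀ n, G n →L[ℂ] G n) : Prop :=
  ∀ (ξ : HilbertSum G) (n : ℕ), (T ξ) n = S n (ξ n)

/-- The operator `T` is bounded on its domain. -/
def IsBoundedOp {E : Type*} [NormedAddCommGroup E] [InnerProductSpace ℂ E]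
    (T : E →ₗ.[ℂ] E) : Prop :=
  ∃ C : ℝ, ∀ ξ : T.domain, ‖T ξ‖ ≤ C * ‖ξ‖

/-- `T` belongs to the Hilbert-Schmidt class: `∑ ‖T eᵢ‖² < ∞` for orthonormal bases `e`. -/
def IsHilbertSchmidt {E : Type*} [NormedAddCommGroup E] [InnerProductSpace ℂ E]
    (T : E →L[ℂ] E) : Prop :=
  ∀ (s : Set E) (e : HilbertBasis s ℂ E), Summable fun i => ‖T (e i)‖ ^ 2

/-- `T` belongs to the trace class: `∑ ⟨eᵢ, |T| eᵢ⟩ < ∞` for orthonormal bases `e`, where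
`|T| = (T* T)^(1/2)`. -/
def IsTraceClass {E : Type*} [NormedAddCommGroup E] [InnerProductSpace ℂ E] [CompleteSpace E]
    (T : E →L[ℂ] E) : Prop :=
  ∀ (s : Set E) (e : HilbertBasis s ℂ E),
    Summable fun i => (inner ℂ (e i) (CFC.abs T (e i))).re

/-- `f(A + B) - f(A) - d/dt f(A + t B) |_{t = 0}` for bounded self-adjoint `A` and `B`, where `f`
is applied by the continuous functional calculus. -/
def taylorRemainder {E : Type*} [NormedAddCommGroup E] [InnerProductSpace ℂ E] [CompleteSpace E]
    (f : ℝ → ℝ) (A B : E →L[ℂ] E) : E →L[ℂ] E :=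
  cfc f (A + B) - cfc f A - deriv (fun t : ℝ => cfc f (A + (t : ℂ) • B)) 0

end

/-! For a polynomial `q`, the Taylor remainder of `q(A + tB)` is `t²` times a second-order matrix,
up to `O(t³)`. Take `A` diagonal with one zero eigenvalue and let `B` couple only that index to the
others, through a unit vector `v`. Away from that index the second-order matrix is `v i * v j * q[a
i, 0, a j]`, a divided-difference multiplier with its middle node frozen at `0`. For `F(x) = x|x|`,
whose second derivative is bounded but jumps at `0`, one has `F[x, 0, y] = (|x| - |y|) / (x - y)`.
At the points `±β^(i+1)`, as `β → ∞`, this kernel tends to constants `±1` on the diagonal blocks and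
to `sign (i - j)`, `sign (j - i)` on the others. With `v` uniform the Hilbert–Schmidt norm stays
bounded, but the trace norm grows at least like `log n`, as for triangular truncation: if `w ^ n =
-1`, the vector of powers of `w` is an eigenvector of the sign kernel with eigenvalue `(1 + w) / (w
- 1)`, and these eigenvalues have a harmonic-type sum.

This limit matrix is reached from genuine remainders of polynomials with `|q''| ≤ 3` by three
limits: `t → 0`, `q → F`, `β → ∞`. The two inequalities wanted (Hilbert–Schmidt bounded, trace norm
large) are open, so some genuine remainder `τ • X` already has them (`exists_block`).

The blocks are glued by scaling: `r² q((x - c) / r)` has second derivative `q''((x - c) / r)`, still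
at most `3`, and affine corrections do not affect the remainder. Choosing `r² τ = 2⁻ʲ` for a block
with trace norm above `2ʲ` makes the squared Hilbert–Schmidt norms of increments and remainders
summable, while each remainder keeps trace norm at least `1`. Centres `c` tending to infinity keep
the intervals disjoint and make `A` unbounded. -/

open scoped ENNReal Real
open Filter Topology Set

/-! ### Functions with prescribed bounded second derivative -/

/-- Continuous bounded functions prescribed on a sequence of consecutive separated intervals. -/
theorem exists_continuous_eqOn_Icc {l u : ℕ → ℝ} {g : ℕ → ℝ → ℝ} {C : ℝ} (hC : 0 ≤ C)
    (hlu : ∀ j, l j ≤ u j) (hsep : ∀ j, u j + 1 ≤ l (j + 1)) (hg : ∀ j, Continuous (g j))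
    (hb : ∀ j, ∀ x ∈ Icc (l j) (u j), |g j x| ≤ C) :
    ∃ h : ℝ → ℝ, Continuous h ∧ (∀ x, |h x| ≤ C) ∧
      ∀ j, ∀ x ∈ Icc (l j) (u j), h x = g j x := by
  classical
  have hstep : ∀ j, l j + 1 ≤ l (j + 1) := fun j => by linarith [hlu j, hsep j]
  have hmono : Monotone l := monotone_nat_of_le_succ fun j => by linarith [hstep j]
  have hlow : ∀ j : ℕ, l 0 + j ≤ l j := by
    intro j
    induction j with
    | zero => simp
    | succ k ih => push_cast; linarith [hstep k]
  have hlt : ∀ i j, i < j → u i < l j := fun i j hij => by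
    linarith [hsep i, hmono (show i + 1 ≤ j from hij)]
  have huniq : ∀ i j x, x ∈ Icc (l i) (u i) → x ∈ Icc (l j) (u j) → i = j := by
    intro i j x hi hj
    rcases lt_trichotomy i j with h | h | h
    · linarith [hlt i j h, hi.2, hj.1]
    · exact h
    · linarith [hlt j i h, hi.1, hj.2]
  -- Since `l j ≥ l 0 + j`, only finitely many intervals meet a left half-line. Local finiteness
  -- makes the union closed and the glued function continuous on it, so that Tietze extension with
  -- values in `[-C, C]` applies.
  have hfin : LocallyFinite fun j => Icc (l j) (u j) := by
    intro x
    refine ⟨Iio (x + 1), Iio_mem_nhds (by linarith), ?_⟩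
    refine (Set.finite_le_nat ⌈x + 1 - l 0⌉₊).subset ?_
    rintro j ⟨y, hy, hy'⟩
    have h1 : (j : ℝ) ≤ ⌈x + 1 - l 0⌉₊ := by
      have := Nat.le_ceil (x + 1 - l 0)
      linarith [hlow j, hy.1, show y < x + 1 from hy']
    exact_mod_cast h1
  let G : ℝ → ℝ := fun x => if hx : ∃ j, x ∈ Icc (l j) (u j) then g hx.choose x else 0
  have hG : ∀ j, ∀ x ∈ Icc (l j) (u j), G x = g j x := by
    intro j x hx
    have hex : ∃ j, x ∈ Icc (l j) (u j) := ⟨j, hx⟩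
    simp only [G, dif_pos hex]
    rw [huniq _ _ x hex.choose_spec hx]
  have hcont : ContinuousOn G (⋃ j, Icc (l j) (u j)) :=
    hfin.continuousOn_iUnion (fun _ => isClosed_Icc)
      fun j => (hg j).continuousOn.congr (hG j)
  have hclosed : IsClosed (⋃ j, Icc (l j) (u j)) := hfin.isClosed_iUnion fun _ => isClosed_Icc
  obtain ⟨h, hh, hr⟩ := ContinuousMap.exists_restrict_eq_forall_mem_of_closed
    (⟨_, hcont.domRestrict⟩ : C((⋃ j, Icc (l j) (u j) : Set ℝ), ℝ)) (t := Icc (-C) C)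
    (by
      rintro ⟨x, hx⟩
      obtain ⟨j, hj⟩ := mem_iUnion.1 hx
      have := hb j x hj
      rw [← hG j x hj] at this
      exact abs_le.1 this) ⟨0, by simpa using hC⟩ hclosed
  refine ⟨h, h.continuous, fun x => abs_le.2 (hh x), fun j x hx => ?_⟩
  have := congrArg (fun k => k ⟨x, mem_iUnion.2 ⟨j, hx⟩⟩) hr
  exact this.trans (hG j x hx)

/-- Every continuous function is the second derivative of a `C²` function. -/
theorem exists_contDiff_two_hasDerivAt {h : ℝ → ℝ} (hh : Continuous h) :
    ∃ f f' : ℝ → ℝ, ContDiff ℝ 2 f ∧ iteratedDeriv 2 f = h ∧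
      (∀ x, HasDerivAt f (f' x) x) ∧ ∀ x, HasDerivAt f' (h x) x := by
  let f' : ℝ → ℝ := fun x => ∫ t in (0 : ℝ)..x, h t
  have h1 : ∀ x, HasDerivAt f' (h x) x := fun x =>
    intervalIntegral.integral_hasDerivAt_right (hh.intervalIntegrable _ _)
      (hh.stronglyMeasurableAtFilter _ _) hh.continuousAt
  have hf' : Continuous f' := continuous_iff_continuousAt.2 fun x => (h1 x).continuousAt
  let f : ℝ → ℝ := fun x => ∫ t in (0 : ℝ)..x, f' t
  have h2 : ∀ x, HasDerivAt f (f' x) x := fun x =>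
    intervalIntegral.integral_hasDerivAt_right (hf'.intervalIntegrable _ _)
      (hf'.stronglyMeasurableAtFilter _ _) hf'.continuousAt
  have e1 : deriv f' = h := funext fun x => (h1 x).deriv
  have e2 : deriv f = f' := funext fun x => (h2 x).deriv
  refine ⟨f, f', ?_, ?_, h2, h1⟩
  · have : (2 : WithTop ℕ∞) = 1 + 1 := by norm_num
    rw [this, contDiff_succ_iff_deriv]
    refine ⟨fun x => (h2 x).differentiableAt, by simp, ?_⟩
    rw [e2, contDiff_one_iff_deriv, e1]
    exact ⟨fun x => (h1 x).differentiableAt, hh⟩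
  · rw [iteratedDeriv_succ, iteratedDeriv_one, e2, e1]

theorem eq_const_of_hasDerivAt_zero_Icc {φ : ℝ → ℝ} {M : ℝ}
    (h : ∀ x ∈ Icc (-M) M, HasDerivAt φ 0 x) : ∀ x ∈ Icc (-M) M, φ x = φ (-M) :=
  constant_of_has_deriv_right_zero (fun x hx => (h x hx).continuousAt.continuousWithinAt)
    fun x hx => (h x (Ico_subset_Icc_self hx)).hasDerivWithinAt

/-- A function whose second derivative is that of a rescaled polynomial on an interval agrees
with this rescaled polynomial up to an affine function. -/
theorem exists_eq_polynomial_add_affine {f f' h : ℝ → ℝ} (hf : ∀ x, HasDerivAt f (f' x) x)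
    (hf' : ∀ x, HasDerivAt f' (h x) x) (q : Polynomial ℝ) {c r M : ℝ}
    (hq : ∀ x ∈ Icc (-M) M, h (c + r * x) = q.derivative.derivative.eval x) :
    ∃ α β : ℝ, ∀ x ∈ Icc (-M) M, f (c + r * x) = r ^ 2 * q.eval x + α + β * x := by
  have haff : ∀ x, HasDerivAt (fun x => c + r * x) r x := fun x => by
    simpa using ((hasDerivAt_id x).const_mul r).const_add c
  have h1 : ∀ x, HasDerivAt (fun x => f' (c + r * x) * r - r ^ 2 * q.derivative.eval x)
      (h (c + r * x) * r * r - r ^ 2 * q.derivative.derivative.eval x) x := fun x =>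
    (((hf' _).comp x (haff x)).mul_const r).sub
      ((q.derivative.hasDerivAt x).const_mul (r ^ 2))
  have h2 := eq_const_of_hasDerivAt_zero_Icc (M := M) (fun x hx => by
    have := h1 x
    rwa [hq x hx, show q.derivative.derivative.eval x * r * r
      - r ^ 2 * q.derivative.derivative.eval x = 0 by ring] at this)
  set β := f' (c + r * -M) * r - r ^ 2 * q.derivative.eval (-M)
  have h3 : ∀ x, HasDerivAt (fun x => f (c + r * x) - r ^ 2 * q.eval x - β * x)
      (f' (c + r * x) * r - r ^ 2 * q.derivative.eval x - β * 1) x := fun x =>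
    (((hf _).comp x (haff x)).sub ((q.hasDerivAt x).const_mul (r ^ 2))).sub
      ((hasDerivAt_id x).const_mul β)
  have h4 := eq_const_of_hasDerivAt_zero_Icc (M := M) (fun x hx => by
    have := h3 x
    rwa [h2 x hx, show β - β * 1 = 0 by ring] at this)
  refine ⟨f (c + r * -M) - r ^ 2 * q.eval (-M) - β * -M, β, fun x hx => ?_⟩
  linarith [h4 x hx]

/-! ### Polynomial approximation of `x|x|` -/

theorem Polynomial.exists_derivative_eq (p : Polynomial ℝ) :
    ∃ q : Polynomial ℝ, q.derivative = p ∧ q.eval 0 = 0 := by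
  induction p using Polynomial.induction_on' with
  | add p q hp hq =>
    obtain ⟨P, hP, hP0⟩ := hp
    obtain ⟨Q, hQ, hQ0⟩ := hq
    exact ⟨P + Q, by simp [hP, hQ], by simp [hP0, hQ0]⟩
  | monomial n a =>
    refine ⟨Polynomial.monomial (n + 1) (a / (n + 1)), ?_, by simp⟩
    rw [Polynomial.derivative_monomial]
    have : ((n : ℝ) + 1) ≠ 0 := by positivity
    simp [div_mul_cancel₀ _ this]

theorem Polynomial.eval_eq_integral_derivative {q : Polynomial ℝ} (hq : q.eval 0 = 0) (x : ℝ) :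
    q.eval x = ∫ t in (0 : ℝ)..x, q.derivative.eval t := by
  rw [intervalIntegral.integral_eq_sub_of_hasDerivAt (fun t _ => q.hasDerivAt t)
    (q.derivative.continuous.intervalIntegrable _ _), hq, sub_zero]

theorem integral_two_mul_sign (x : ℝ) : ∫ t in (0 : ℝ)..x, 2 * (SignType.sign t : ℝ) = 2 * |x| := by
  rcases le_total 0 x with h | h
  · rw [intervalIntegral.integral_congr_ae (g := fun _ => 2), abs_of_nonneg h]
    · simp; ring
    · refine .of_forall fun t ht => ?_
      rw [uIoc_of_le h] at ht
      simp [sign_pos ht.1]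
  · rw [intervalIntegral.integral_symm, intervalIntegral.integral_congr_ae (g := fun _ => -2),
      abs_of_nonpos h]
    · simp; ring
    · filter_upwards [MeasureTheory.Measure.ae_ne MeasureTheory.volume 0] with t h0 ht
      rw [uIoc_of_le h] at ht
      simp [sign_neg (lt_of_le_of_ne ht.2 h0)]

theorem integral_two_mul_abs (x : ℝ) : ∫ t in (0 : ℝ)..x, 2 * |t| = x * |x| := by
  rcases le_total 0 x with h | h
  · rw [intervalIntegral.integral_congr (g := fun t => 2 * t), abs_of_nonneg h]
    · rw [intervalIntegral.integral_const_mul, integral_id]; ring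
    · intro t ht
      rw [uIcc_of_le h] at ht
      simp [abs_of_nonneg ht.1]
  · rw [intervalIntegral.integral_congr (g := fun t => (-2) * t), abs_of_nonpos h]
    · rw [intervalIntegral.integral_const_mul, integral_id]; ring
    · intro t ht
      rw [uIcc_of_ge h] at ht
      simp [abs_of_nonpos ht.2]

/-- Polynomials with bounded second derivative that converge to `x ↦ x |x|` together with
their first derivatives. -/
theorem exists_polynomial_tendsto_mul_abs (M : ℝ) :
    ∃ q : ℕ → Polynomial ℝ,
      (∀ m, (q m).eval 0 = 0) ∧ (∀ m, (q m).derivative.eval 0 = 0) ∧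
      (∀ m, ∀ x ∈ Icc (-M) M, |(q m).derivative.derivative.eval x| ≤ 3) ∧
      (∀ x ∈ Icc (-M) M, Tendsto (fun m => (q m).derivative.eval x) atTop (𝓝 (2 * |x|))) ∧
      ∀ x ∈ Icc (-M) M, Tendsto (fun m => (q m).eval x) atTop (𝓝 (x * |x|)) := by
  -- A continuous approximation, bounded by `2`, of `2 sign x`, the second derivative of `x|x|`. A
  -- Weierstrass error at most `1` gives the bound `3`; two integrations by dominated convergence
  -- then recover `2|x|` and `x|x|`.
  let s : ℕ → ℝ → ℝ := fun m x => 2 * (m * x / (1 + |m * x|))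
  have hpos : ∀ (m : ℕ) (x : ℝ), 0 < 1 + |m * x| := fun m x => by positivity
  have hs : ∀ m, Continuous (s m) := fun m =>
    continuous_const.mul (by
      refine Continuous.div (by fun_prop) (by fun_prop) fun x => (hpos m x).ne')
  have hsb : ∀ m x, |s m x| ≤ 2 := fun m x => by
    simp only [s]
    rw [abs_mul, abs_div, abs_of_pos (hpos m x), abs_two]
    have : |(m : ℝ) * x| / (1 + |m * x|) ≤ 1 := by
      rw [div_le_one (hpos m x)]; linarith
    linarith
  have hsl : ∀ x, Tendsto (fun m => s m x) atTop (𝓝 (2 * (SignType.sign x : ℝ))) := by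
    intro x
    refine Tendsto.const_mul 2 ?_
    rcases eq_or_ne x 0 with rfl | hx
    · simp
    · have h1 : Tendsto (fun m : ℕ => (m : ℝ) * |x|) atTop atTop :=
        tendsto_natCast_atTop_atTop.atTop_mul_const (abs_pos.2 hx)
      have h2 : Tendsto (fun m : ℕ => (SignType.sign x : ℝ) * (1 - (1 + (m : ℝ) * |x|)⁻¹)) atTop
          (𝓝 ((SignType.sign x : ℝ) * (1 - 0))) :=
        ((tendsto_inv_atTop_zero.comp (tendsto_atTop_add_const_left _ 1 h1)).const_sub 1).const_mul _
      rw [sub_zero, mul_one] at h2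
      refine h2.congr fun m => ?_
      have h3 : (1 : ℝ) + m * |x| ≠ 0 := by positivity
      have h4 : |(m : ℝ) * x| = m * |x| := by rw [abs_mul, Nat.abs_cast]
      rw [h4]
      have h5 : (SignType.sign x : ℝ) * |x| = x := sign_mul_abs x
      field_simp
      rw [add_sub_cancel_left, mul_left_comm, h5]
  have hp : ∀ m : ℕ, ∃ p : Polynomial ℝ, ∀ x ∈ Icc (-M) M, |p.eval x - s m x| < 1 / (m + 1) :=
    fun m => exists_polynomial_near_of_continuousOn _ _ _ (hs m).continuousOn _ (by positivity)
  choose p hp using hp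
  choose p₁ hp₁ hp₁0 using fun m => (p m).exists_derivative_eq
  choose q hq hq0 using fun m => (p₁ m).exists_derivative_eq
  have hpb : ∀ m, ∀ x ∈ Icc (-M) M, |(p m).eval x| ≤ 3 := fun m x hx => by
    have h1 := hp m x hx
    have h2 := hsb m x
    have h3 : (1 : ℝ) / (m + 1) ≤ 1 := by
      rw [div_le_one (by positivity)]; linarith [(Nat.cast_nonneg m : (0 : ℝ) ≤ m)]
    rw [abs_lt] at h1
    rw [abs_le] at h2 ⊢
    constructor <;> linarith [h1.1, h1.2, h2.1, h2.2]
  have hpl : ∀ x ∈ Icc (-M) M,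
      Tendsto (fun m => (p m).eval x) atTop (𝓝 (2 * (SignType.sign x : ℝ))) := by
    intro x hx
    have h1 : Tendsto (fun m => (p m).eval x - s m x) atTop (𝓝 0) :=
      squeeze_zero_norm (fun m => (hp m x hx).le) tendsto_one_div_add_atTop_nhds_zero_nat
    simpa using h1.add (hsl x)
  have hsub : ∀ x ∈ Icc (-M) M, ∀ t ∈ uIoc 0 x, t ∈ Icc (-M) M ∧ |t| ≤ |x| := by
    intro x hx t ht
    rcases le_total 0 x with h | h
    · rw [uIoc_of_le h] at ht
      exact ⟨⟨by linarith [hx.1, ht.1, hx.2, ht.2], by linarith [hx.2, ht.2]⟩,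
        abs_le_abs_of_nonneg ht.1.le ht.2⟩
    · rw [uIoc_of_ge h] at ht
      exact ⟨⟨by linarith [hx.1, ht.1], by linarith [hx.1, ht.1, ht.2]⟩,
        abs_le_abs_of_nonpos ht.2 ht.1.le⟩
  have hl1 : ∀ x ∈ Icc (-M) M, Tendsto (fun m => (p₁ m).eval x) atTop (𝓝 (2 * |x|)) := by
    intro x hx
    rw [← integral_two_mul_sign]
    simp only [Polynomial.eval_eq_integral_derivative (hp₁0 _) x, hp₁]
    refine intervalIntegral.tendsto_integral_filter_of_dominated_convergence (fun _ => 3)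
      (.of_forall fun m => (p m).continuous.aestronglyMeasurable)
      (.of_forall fun m => .of_forall fun t ht => hpb m t (hsub x hx t ht).1)
      intervalIntegrable_const
      (.of_forall fun t ht => hpl t (hsub x hx t ht).1)
  have hb1 : ∀ m, ∀ x ∈ Icc (-M) M, |(p₁ m).eval x| ≤ 3 * |x| := by
    intro m x hx
    rw [Polynomial.eval_eq_integral_derivative (hp₁0 _) x, hp₁]
    simpa using intervalIntegral.norm_integral_le_of_norm_le_const (a := 0) (b := x)
      (f := fun t => (p m).eval t) (C := 3) (fun t ht => hpb m t (hsub x hx t ht).1)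
  refine ⟨q, hq0, fun m => by rw [hq, hp₁0], fun m x hx => by rw [hq, hp₁]; exact hpb m x hx,
    fun x hx => by simpa only [hq] using hl1 x hx, fun x hx => ?_⟩
  rw [← integral_two_mul_abs]
  simp only [Polynomial.eval_eq_integral_derivative (hq0 _) x, hq]
  refine intervalIntegral.tendsto_integral_filter_of_dominated_convergence (fun _ => 3 * |x|)
      (.of_forall fun m => (p₁ m).continuous.aestronglyMeasurable)
      (.of_forall fun m => .of_forall fun t ht => (hb1 m t (hsub x hx t ht).1).trans
        (by linarith [(hsub x hx t ht).2]))
      intervalIntegrable_const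
      (.of_forall fun t ht => hl1 t (hsub x hx t ht).1)

/-! ### Second-order expansion of a polynomial at a diagonal matrix -/

section Expansion

variable {R : Type*} [Ring R]

/-- First order coefficient of the expansion of `(a + t b) ^ k` in powers of `t`. -/
def powCoeffOne (a b : R) : ℕ → R
  | 0 => 0
  | k + 1 => powCoeffOne a b k * a + a ^ k * b

/-- Second order coefficient of the expansion of `(a + t b) ^ k` in powers of `t`. -/
def powCoeffTwo (a b : R) : ℕ → R
  | 0 => 0
  | k + 1 => powCoeffTwo a b k * a + powCoeffOne a b k * b

/-- Continuity of `E` is all that is needed of the error: after subtracting the first-order part and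
dividing by `t²`, what remains is `powCoeffTwo + t • E t`. -/
theorem exists_pow_add_smul_eq [Algebra ℝ R] [TopologicalSpace R] [IsTopologicalRing R]
    [ContinuousSMul ℝ R] (a b : R) (k : ℕ) :
    ∃ E : ℝ → R, Continuous E ∧ ∀ t : ℝ, (a + t • b) ^ k =
      a ^ k + t • powCoeffOne a b k + t ^ 2 • powCoeffTwo a b k + t ^ 3 • E t := by
  induction k with
  | zero => exact ⟨0, continuous_const, fun t => by simp [powCoeffOne, powCoeffTwo]⟩
  | succ k ih =>
    obtain ⟨E, hE, h⟩ := ih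
    refine ⟨fun t => E t * (a + t • b) + powCoeffTwo a b k * b, by fun_prop, fun t => ?_⟩
    rw [pow_succ, h t, pow_succ a, powCoeffOne, powCoeffTwo]
    simp only [add_mul, mul_add, smul_mul_assoc, mul_smul_comm]
    module

end Expansion

section Arrow

variable {ι : Type*} [Fintype ι] [DecidableEq ι]

/-- The matrix whose row and column of index `o` have the entries `v`, and which vanishes
elsewhere. -/
def arrowMatrix (o : ι) (v : ι → ℝ) : Matrix ι ι ℂ := fun i j =>
  if j = o then (v i : ℂ) else if i = o then (v j : ℂ) else 0

/-- The real diagonal matrix with entries `a`. -/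
def realDiagonal (a : ι → ℝ) : Matrix ι ι ℂ := Matrix.diagonal fun i => (a i : ℂ)

/-- The second order divided difference `q[x, 0, y]` of the polynomial `q`, for nonzero `x`
and `y`. -/
noncomputable def dividedDiffZero (q : Polynomial ℝ) (x y : ℝ) : ℝ :=
  if x = y then q.derivative.eval x / x - (q.eval x - q.eval 0) / x ^ 2
  else ((q.eval x - q.eval 0) / x - (q.eval y - q.eval 0) / y) / (x - y)

/-- The second order term of the expansion of `q(A + tB)` at `t = 0` for the diagonal matrix `A`
with entries `a` and the arrow matrix `B` with entries `v`. -/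
noncomputable def secondOrderMatrix (o : ι) (a v : ι → ℝ) (q : Polynomial ℝ) : Matrix ι ι ℂ := fun i j =>
  if j = o then
    if i = o then
      ((∑ l, v l ^ 2 * ((q.eval (a l) - q.eval 0 - q.derivative.eval 0 * a l) / a l ^ 2) : ℝ) : ℂ)
    else 0
  else ((v i * v j * dividedDiffZero q (a i) (a j) : ℝ) : ℂ)

theorem dividedDiffZero_add (p q : Polynomial ℝ) (x y : ℝ) :
    dividedDiffZero (p + q) x y = dividedDiffZero p x y + dividedDiffZero q x y := by
  simp only [dividedDiffZero]
  split_ifs <;> simp only [Polynomial.derivative_add, Polynomial.eval_add] <;> ring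

theorem dividedDiffZero_C_mul (c : ℝ) (q : Polynomial ℝ) (x y : ℝ) :
    dividedDiffZero (Polynomial.C c * q) x y = c * dividedDiffZero q x y := by
  simp only [dividedDiffZero]
  split_ifs <;> simp <;> ring

theorem secondOrderMatrix_add (o : ι) (a v : ι → ℝ) (p q : Polynomial ℝ) :
    secondOrderMatrix o a v (p + q) = secondOrderMatrix o a v p + secondOrderMatrix o a v q := by
  ext i j
  simp only [secondOrderMatrix, Matrix.add_apply]
  split_ifs
  · rw [← Complex.ofReal_add, ← Finset.sum_add_distrib]
    congr 1
    refine Finset.sum_congr rfl fun l _ => ?_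
    simp only [Polynomial.derivative_add, Polynomial.eval_add]
    ring
  · simp
  · rw [dividedDiffZero_add]
    push_cast
    ring

theorem secondOrderMatrix_C_mul (o : ι) (a v : ι → ℝ) (c : ℝ) (q : Polynomial ℝ) :
    secondOrderMatrix o a v (Polynomial.C c * q) = c • secondOrderMatrix o a v q := by
  ext i j
  simp only [secondOrderMatrix, Matrix.smul_apply]
  split_ifs
  · rw [Complex.real_smul, ← Complex.ofReal_mul, Finset.mul_sum]
    congr 1
    refine Finset.sum_congr rfl fun l _ => ?_
    simp
    ring
  · simp
  · rw [dividedDiffZero_C_mul, Complex.real_smul]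
    push_cast
    ring

/-- The node `0` lowers the degree by one: this is the first divided difference of `X ^ k`, a
geometric sum. For `k = 0` the sum is empty, so the truncated `k - 1` is harmless. -/
theorem dividedDiffZero_X_pow_succ (k : ℕ) {x y : ℝ} (hx : x ≠ 0) (hy : y ≠ 0) :
    dividedDiffZero (Polynomial.X ^ (k + 1)) x y =
      ∑ l ∈ Finset.range k, x ^ l * y ^ (k - 1 - l) := by
  simp only [dividedDiffZero, Polynomial.eval_pow, Polynomial.eval_X, Polynomial.derivative_X_pow,
    Polynomial.eval_mul, Polynomial.eval_C, ne_eq, Nat.succ_ne_zero, not_false_eq_true,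
    zero_pow, sub_zero, Nat.add_sub_cancel]
  split_ifs with h
  · subst h
    rw [Finset.sum_congr rfl (g := fun _ => x ^ (k - 1))]
    · rcases k with - | k
      · simp
        field_simp
        norm_num
      · simp
        field_simp
        ring
    · intro l hl
      rw [← pow_add]
      congr 1
      have := Finset.mem_range.1 hl
      omega
  · rw [pow_succ, pow_succ, mul_div_cancel_right₀ _ hx, mul_div_cancel_right₀ _ hy,
      div_eq_iff (sub_ne_zero.2 h), geom_sum₂_mul]

variable {o : ι} {a v : ι → ℝ}

/-- The coefficient is the sum of the words `a^p b a^q` with `p + q = k`. Every nonzero entry of `b`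
touches `o`, where `a` vanishes, so no power of `a` survives on that side. -/
theorem powCoeffOne_arrow (ha : a o = 0) (hv : v o = 0) (k : ℕ) (i j : ι) :
    powCoeffOne (realDiagonal a) (arrowMatrix o v) (k + 1) i j =
      if j = o then (a i : ℂ) ^ k * v i else if i = o then (a j : ℂ) ^ k * v j else 0 := by
  induction k with
  | zero => simp [powCoeffOne, arrowMatrix]
  | succ k ih =>
    rw [powCoeffOne, Matrix.add_apply, realDiagonal, Matrix.mul_diagonal, ← realDiagonal, ih,
      realDiagonal, Matrix.diagonal_pow, Matrix.diagonal_mul, arrowMatrix]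
    by_cases hj : j = o
    · subst hj; simp [ha]
    · by_cases hi : i = o
      · subst hi; simp [hj, ha]; ring
      · simp [hi, hj]

/-- In a word `a^p b a^q b a^r`, a path between indices `i, j ≠ o` must pass through `o`, which
forces `q = 0` and leaves a geometric sum. A path from `o` to `o` goes through some `l ≠ o`, which
forces `p = r = 0`. The mixed entries vanish because `b` exchanges `o` with the other indices. -/
theorem powCoeffTwo_arrow (ha : a o = 0) (hv : v o = 0) (k : ℕ) (i j : ι) :
    powCoeffTwo (realDiagonal a) (arrowMatrix o v) (k + 1) i j =
      if j = o then if i = o then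
        if k = 0 then 0 else ∑ l, (v l : ℂ) ^ 2 * (a l : ℂ) ^ (k - 1) else 0
      else v i * v j * ∑ l ∈ Finset.range k, (a i : ℂ) ^ l * (a j : ℂ) ^ (k - 1 - l) := by
  induction k with
  | zero => simp [powCoeffTwo, powCoeffOne]
  | succ k ih =>
    rw [powCoeffTwo, Matrix.add_apply, realDiagonal, Matrix.mul_diagonal, ← realDiagonal, ih,
      Matrix.mul_apply]
    simp only [powCoeffOne_arrow ha hv, arrowMatrix]
    by_cases hj : j = o
    · subst hj
      by_cases hi : i = j
      · subst hi
        simp only [if_true, ha, Complex.ofReal_zero, mul_zero, zero_add, Nat.succ_ne_zero,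
          if_false, Nat.add_sub_cancel]
        refine Finset.sum_congr rfl fun l _ => ?_
        by_cases hl : l = i
        · subst hl; simp [hv]
        · simp [hl]; ring
      · simp only [if_true, if_neg hi, zero_mul, zero_add]
        refine Finset.sum_eq_zero fun l _ => ?_
        by_cases hl : l = j
        · subst hl; simp [hv]
        · simp [hl]
    · simp only [if_neg hj]
      rw [Finset.sum_eq_single o]
      · simp only [if_true]
        rw [Finset.sum_range_succ, Nat.add_sub_cancel, Nat.sub_self, pow_zero, mul_one, mul_add]
        congr 1
        · rw [mul_assoc, Finset.sum_mul]
          congr 1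
          refine Finset.sum_congr rfl fun l hl => ?_
          have := Finset.mem_range.1 hl
          rw [mul_assoc, ← pow_succ]
          congr 2
          omega
        · ring
      · intro l _ hl
        simp [hl]
      · simp

theorem powCoeffTwo_eq_secondOrderMatrix (ha : a o = 0) (ha' : ∀ i, i ≠ o → a i ≠ 0)
    (hv : v o = 0) (k : ℕ) :
    powCoeffTwo (realDiagonal a) (arrowMatrix o v) k = secondOrderMatrix o a v (.X ^ k) := by
  ext i j
  rcases k with - | k
  · simp [powCoeffTwo, secondOrderMatrix, dividedDiffZero]
  rw [powCoeffTwo_arrow ha hv, secondOrderMatrix]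
  by_cases hj : j = o
  · subst hj
    by_cases hi : i = j
    · subst hi
      simp only [if_true]
      rcases k with - | k
      · simp
      · simp only [Nat.succ_ne_zero, if_false, Complex.ofReal_sum, Nat.add_sub_cancel]
        refine Finset.sum_congr rfl fun l _ => ?_
        -- At the zero eigenvalue the quotient by `a l ^ 2` is a division by zero; the weight `v o =
        -- 0` makes its value irrelevant.
        by_cases hl : l = i
        · subst hl; simp [hv]
        · have := ha' l hl
          simp only [Polynomial.eval_pow, Polynomial.eval_X, Polynomial.derivative_X_pow]
          have h2 : (a l ^ (k + 1 + 1) / a l ^ 2) = a l ^ k := by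
            field_simp
            ring
          simp
          left
          norm_cast
          rw [h2]
    · simp [hi]
  · simp only [if_neg hj]
    by_cases hi : i = o
    · subst hi; simp [hv]
    · rw [dividedDiffZero_X_pow_succ _ (ha' i hi) (ha' j hj)]
      push_cast
      rfl

/-- The first-order term `D` is left unspecified because it cancels in the Taylor remainder. -/
theorem exists_aeval_add_smul_eq (ha : a o = 0) (ha' : ∀ i, i ≠ o → a i ≠ 0) (hv : v o = 0)
    (q : Polynomial ℝ) :
    ∃ (D : Matrix ι ι ℂ) (E : ℝ → Matrix ι ι ℂ), Continuous E ∧ ∀ t : ℝ,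
      Polynomial.aeval (realDiagonal a + t • arrowMatrix o v) q =
        Polynomial.aeval (realDiagonal a) q + t • D + t ^ 2 • secondOrderMatrix o a v q
          + t ^ 3 • E t := by
  induction q using Polynomial.induction_on' with
  | add p q hp hq =>
    obtain ⟨D, E, hE, h⟩ := hp
    obtain ⟨D', E', hE', h'⟩ := hq
    refine ⟨D + D', fun t => E t + E' t, hE.add hE', fun t => ?_⟩
    rw [map_add, map_add, h, h', secondOrderMatrix_add]
    simp only [smul_add]
    abel
  | monomial k c =>
    obtain ⟨E, hE, h⟩ := exists_pow_add_smul_eq (realDiagonal a) (arrowMatrix o v) k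
    refine ⟨c • powCoeffOne (realDiagonal a) (arrowMatrix o v) k, fun t => c • E t,
      hE.const_smul c, fun t => ?_⟩
    rw [← Polynomial.C_mul_X_pow_eq_monomial, secondOrderMatrix_C_mul,
      ← powCoeffTwo_eq_secondOrderMatrix ha ha' hv]
    simp only [map_mul, Polynomial.aeval_C, map_pow, Polynomial.aeval_X, ← Algebra.smul_def]
    rw [h t]
    simp only [smul_add, smul_comm c]

end Arrow

/-! ### Limits of normalized Taylor remainders -/

theorem isSelfAdjoint_realDiagonal {ι : Type*} [DecidableEq ι] (a : ι → ℝ) : IsSelfAdjoint (realDiagonal a) := by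
  rw [IsSelfAdjoint, realDiagonal, Matrix.star_eq_conjTranspose, Matrix.diagonal_conjTranspose]
  congr 1
  ext i
  simp

theorem isSelfAdjoint_arrowMatrix {ι : Type*} [DecidableEq ι] (o : ι) (v : ι → ℝ) : IsSelfAdjoint (arrowMatrix o v) := by
  ext i j
  rw [Matrix.star_apply]
  simp only [arrowMatrix]
  by_cases hi : i = o <;> by_cases hj : j = o <;> simp [hi, hj]

section Attainable

variable {ι : Type*} [Fintype ι] [DecidableEq ι]
  {V : Type*} [NormedAddCommGroup V] [InnerProductSpace ℂ V] [CompleteSpace V]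

/-- The operators `X` such that, for some polynomial `q` with `|q''| ≤ 3` near the spectra
involved, `τ X` is the Taylor remainder `q(A + B) - q(A) - d/ds q(A + sB)|_{s = 0}` with
`‖B‖² ≤ 2τ` in the Hilbert-Schmidt norm. -/
def normalizedRemainders (b : OrthonormalBasis ι ℂ V) : Set (V →L[ℂ] V) :=
  {X | ∃ (A B D : V →L[ℂ] V) (q : Polynomial ℝ) (M τ : ℝ),
    IsSelfAdjoint A ∧ IsSelfAdjoint B ∧ ‖A‖ + ‖B‖ < M ∧
    (∀ x ∈ Icc (-M) M, |q.derivative.derivative.eval x| ≤ 3) ∧ 0 < τ ∧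
    ∑ i, ‖B (b i)‖ ^ 2 ≤ 2 * τ ∧
    HasDerivAt (fun s : ℝ => Polynomial.aeval (A + (s : ℂ) • B) q) D 0 ∧
    Polynomial.aeval (A + B) q - Polynomial.aeval A q - D = τ • X}

/-- The operator with a given matrix in an orthonormal basis, as a morphism of real algebras. -/
noncomputable def matrixOp (b : OrthonormalBasis ι ℂ V) : Matrix ι ι ℂ →ₐ[ℝ] (V →L[ℂ] V) :=
  (((Matrix.toEuclideanCLM (n := ι) (𝕜 := ℂ)).trans
    b.repr.symm.conjStarAlgEquiv).toAlgEquiv.toAlgHom).restrictScalars ℝ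

variable (b : OrthonormalBasis ι ℂ V)

theorem matrixOp_apply (M : Matrix ι ι ℂ) (x : V) :
    matrixOp b M x = b.repr.symm (Matrix.toEuclideanCLM (n := ι) (𝕜 := ℂ) M (b.repr x)) := rfl

theorem continuous_matrixOp : Continuous (matrixOp b) :=
  (matrixOp b).toLinearMap.continuous_of_finiteDimensional

theorem isSelfAdjoint_matrixOp {M : Matrix ι ι ℂ} (hM : IsSelfAdjoint M) :
    IsSelfAdjoint (matrixOp b M) :=
  hM.map ((Matrix.toEuclideanCLM (n := ι) (𝕜 := ℂ)).trans b.repr.symm.conjStarAlgEquiv)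

theorem repr_matrixOp (M : Matrix ι ι ℂ) (x : V) (i : ι) :
    b.repr (matrixOp b M x) i = ∑ j, M i j * b.repr x j := by
  rw [matrixOp_apply, LinearIsometryEquiv.apply_symm_apply, Matrix.ofLp_toEuclideanCLM]
  rfl

theorem sum_norm_sq_matrixOp (M : Matrix ι ι ℂ) :
    ∑ j, ‖matrixOp b M (b j)‖ ^ 2 = ∑ j, ∑ i, ‖M i j‖ ^ 2 := by
  refine Finset.sum_congr rfl fun j _ => ?_
  rw [← b.repr.norm_map, EuclideanSpace.norm_sq_eq]
  refine Finset.sum_congr rfl fun i _ => ?_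
  rw [repr_matrixOp]
  simp

theorem inner_matrixOp (M : Matrix ι ι ℂ) (u : V) :
    inner ℂ u (matrixOp b M u) = ∑ i, ∑ j, star (b.repr u i) * M i j * b.repr u j := by
  rw [← b.repr.inner_map_map, PiLp.inner_apply]
  refine Finset.sum_congr rfl fun i _ => ?_
  rw [repr_matrixOp, RCLike.inner_apply, Finset.sum_mul]
  refine Finset.sum_congr rfl fun j _ => ?_
  simp
  ring

/-- The unit vector `v` occurs once as a column and once as a row; this is the `2` of `2 * τ` in
`normalizedRemainders`. -/
theorem sum_norm_sq_arrowMatrix_le (o : ι) {v : ι → ℝ} (hv : v o = 0) (hs : ∑ i, v i ^ 2 = 1) :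
    ∑ j, ∑ i, ‖arrowMatrix o v i j‖ ^ 2 ≤ 2 := by
  have h : ∀ j, ∑ i, ‖arrowMatrix o v i j‖ ^ 2 = (if j = o then 1 else 0) + v j ^ 2 := by
    intro j
    by_cases hj : j = o
    · subst hj
      simp [arrowMatrix, hv, hs]
    · rw [Finset.sum_eq_single o]
      · simp [arrowMatrix, hj]
      · intro i _ hi
        simp [arrowMatrix, hj, hi]
      · simp
  simp only [h, Finset.sum_add_distrib, hs]
  simp
  norm_num

theorem hasDerivAt_smul_zero {W : Type*} [NormedAddCommGroup W] [NormedSpace ℝ W] {g : ℝ → W}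
    (hg : Continuous g) (c : W) : HasDerivAt (fun s : ℝ => c + s • g s) (g 0) 0 := by
  rw [hasDerivAt_iff_tendsto_slope_zero]
  have h : Tendsto g (𝓝[≠] 0) (𝓝 (g 0)) := hg.continuousAt.tendsto.mono_left nhdsWithin_le_nhds
  refine h.congr' ?_
  filter_upwards [self_mem_nhdsWithin] with t ht
  simp [inv_smul_smul₀ (show t ≠ 0 from ht)]

theorem hasDerivAt_aeval_of_expansion {R : Type*} [NormedRing R] [NormedAlgebra ℝ R]
    {A B D S : R} {E : ℝ → R} (hE : Continuous E) {q : Polynomial ℝ}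
    (h : ∀ t : ℝ, Polynomial.aeval (A + t • B) q =
      Polynomial.aeval A q + t • D + t ^ 2 • S + t ^ 3 • E t) (t : ℝ) :
    HasDerivAt (fun s : ℝ => Polynomial.aeval (A + s • t • B) q) (t • D) 0 := by
  have h2 : ∀ s : ℝ, Polynomial.aeval (A + s • t • B) q =
      Polynomial.aeval A q + s • (t • D + (s * t ^ 2) • S + (s ^ 2 * t ^ 3) • E (s * t)) := by
    intro s
    rw [smul_smul, h]
    module
  simp only [h2]
  have h3 : Continuous fun s : ℝ => t • D + (s * t ^ 2) • S + (s ^ 2 * t ^ 3) • E (s * t) := by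
    fun_prop
  simpa using hasDerivAt_smul_zero h3 (Polynomial.aeval A q)

theorem aeval_sub_sub_of_expansion {R : Type*} [NormedRing R] [NormedAlgebra ℝ R]
    {A B D S : R} {E : ℝ → R} {q : Polynomial ℝ}
    (h : ∀ t : ℝ, Polynomial.aeval (A + t • B) q =
      Polynomial.aeval A q + t • D + t ^ 2 • S + t ^ 3 • E t) (t : ℝ) :
    Polynomial.aeval (A + t • B) q - Polynomial.aeval A q - t • D =
      t ^ 2 • (S + t • E t) := by
  rw [h]
  module

theorem tendsto_add_smul_nhdsGT {R : Type*} [NormedRing R] [NormedAlgebra ℝ R]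
    {E : ℝ → R} (hE : Continuous E) (S : R) :
    Tendsto (fun t : ℝ => S + t • E t) (𝓝[>] 0) (𝓝 S) := by
  have : Continuous fun t : ℝ => S + t • E t := by fun_prop
  have h1 := this.tendsto 0
  simp only [zero_smul, add_zero] at h1
  exact h1.mono_left nhdsWithin_le_nhds

theorem isSelfAdjoint_real_smul {B : V →L[ℂ] V} (hB : IsSelfAdjoint B) (t : ℝ) :
    IsSelfAdjoint (t • B) := by
  rw [← Complex.coe_smul, IsSelfAdjoint, star_smul, hB.star_eq]
  simp

omit [DecidableEq ι] in
-- The increment `t • B` with `τ = t²` has normalized remainder `S + t • E t`, which tends to `S`.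
-- Since `‖A‖ < M` is strict, the norm constraint also holds for small `t`.
theorem mem_closure_normalizedRemainders {A B D S : V →L[ℂ] V} {E : ℝ → V →L[ℂ] V}
    (hE : Continuous E) (hA : IsSelfAdjoint A) (hB : IsSelfAdjoint B) {M : ℝ} (hM : ‖A‖ < M)
    {q : Polynomial ℝ} (hq : ∀ x ∈ Icc (-M) M, |q.derivative.derivative.eval x| ≤ 3)
    (hBs : ∑ i, ‖B (b i)‖ ^ 2 ≤ 2)
    (h : ∀ t : ℝ, Polynomial.aeval (A + t • B) q =
      Polynomial.aeval A q + t • D + t ^ 2 • S + t ^ 3 • E t) :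
    S ∈ closure (normalizedRemainders b) := by
  have h1 : ∀ᶠ t : ℝ in 𝓝[>] 0, ‖A‖ + |t| * ‖B‖ < M := by
    have : Continuous fun t : ℝ => ‖A‖ + |t| * ‖B‖ := by fun_prop
    have h1 := this.tendsto 0
    simp only [abs_zero, zero_mul, add_zero] at h1
    exact (h1.mono_left nhdsWithin_le_nhds).eventually_lt_const hM
  refine mem_closure_of_tendsto (tendsto_add_smul_nhdsGT hE S) ?_
  filter_upwards [h1, self_mem_nhdsWithin] with t ht ht0
  have e1 : IsSelfAdjoint (t • B) := isSelfAdjoint_real_smul hB t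
  have e2 : ‖A‖ + ‖t • B‖ < M := by rwa [norm_smul, Real.norm_eq_abs]
  have e3 : ∑ i, ‖(t • B) (b i)‖ ^ 2 ≤ 2 * t ^ 2 := by
    simp only [smul_apply, norm_smul, mul_pow, ← Finset.mul_sum]
    rw [Real.norm_eq_abs, sq_abs, mul_comm]
    exact mul_le_mul_of_nonneg_right hBs (sq_nonneg t)
  have e4 : HasDerivAt (fun s : ℝ => Polynomial.aeval (A + (s : ℂ) • t • B) q) (t • D) 0 := by
    simp only [Complex.coe_smul]
    exact hasDerivAt_aeval_of_expansion hE h t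
  exact ⟨A, t • B, t • D, q, M, t ^ 2, hA, e1, e2, hq, pow_pos ht0 2, e3, e4,
    aeval_sub_sub_of_expansion h t⟩

variable {o : ι} {a v : ι → ℝ}

theorem secondOrderMatrix_mem_closure (ha : a o = 0) (ha' : ∀ i, i ≠ o → a i ≠ 0) (hv : v o = 0)
    (hs : ∑ i, v i ^ 2 = 1) {M : ℝ} (hM : ‖matrixOp b (realDiagonal a)‖ < M) (q : Polynomial ℝ)
    (hq : ∀ x ∈ Icc (-M) M, |q.derivative.derivative.eval x| ≤ 3) :
    matrixOp b (secondOrderMatrix o a v q) ∈ closure (normalizedRemainders b) := by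
  obtain ⟨D, E, hE, h⟩ := exists_aeval_add_smul_eq ha ha' hv q
  refine mem_closure_normalizedRemainders b (D := matrixOp b D)
    (E := fun t => matrixOp b (E t)) ((continuous_matrixOp b).comp hE)
    (isSelfAdjoint_matrixOp b (isSelfAdjoint_realDiagonal a))
    (isSelfAdjoint_matrixOp b (isSelfAdjoint_arrowMatrix o v)) hM hq ?_ fun t => ?_
  · rw [sum_norm_sq_matrixOp]
    exact sum_norm_sq_arrowMatrix_le o hv hs
  · rw [← map_smul, ← map_add, Polynomial.aeval_algHom_apply, Polynomial.aeval_algHom_apply, h t]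
    simp only [map_add, map_smul]

/-- The second order divided difference `F[x, 0, y]` of `F(x) = x |x|`, for nonzero `x` and
`y`. -/
noncomputable def signDividedDiff (x y : ℝ) : ℝ :=
  if x = y then 2 * |x| / x - x * |x| / x ^ 2
  else (x * |x| / x - y * |y| / y) / (x - y)

/-- The limit of `secondOrderMatrix` for polynomials converging to `x |x|`. -/
noncomputable def signSecondOrderMatrix (o : ι) (a v : ι → ℝ) : Matrix ι ι ℂ := fun i j =>
  if j = o then
    if i = o then ((∑ l, v l ^ 2 * (a l * |a l| / a l ^ 2) : ℝ) : ℂ) else 0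
  else ((v i * v j * signDividedDiff (a i) (a j) : ℝ) : ℂ)

theorem tendsto_matrixOp {α : Type*} {f : Filter α} {S : α → Matrix ι ι ℂ} {T : Matrix ι ι ℂ}
    (h : ∀ i j, Tendsto (fun m => S m i j) f (𝓝 (T i j))) :
    Tendsto (fun m => matrixOp b (S m)) f (𝓝 (matrixOp b T)) :=
  ((continuous_matrixOp b).tendsto T).comp
    (tendsto_pi_nhds.2 fun i => tendsto_pi_nhds.2 fun j => h i j)

/-- The second-order matrix involves only `q` and `q'` at finitely many points. Convergence of these
to `x|x|` and `2|x|` is enough; `q''` need only stay bounded. -/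
theorem signSecondOrderMatrix_mem_closure (ha : a o = 0) (ha' : ∀ i, i ≠ o → a i ≠ 0)
    (hv : v o = 0) (hs : ∑ i, v i ^ 2 = 1) :
    matrixOp b (signSecondOrderMatrix o a v) ∈ closure (normalizedRemainders b) := by
  -- Large enough to exceed the norm of the diagonal operator strictly and to contain every `a i` in
  -- `[-M, M]`.
  set M := ‖matrixOp b (realDiagonal a)‖ + 1 + ∑ i, |a i| with hM
  have hsum : 0 ≤ ∑ i, |a i| := Finset.sum_nonneg fun i _ => abs_nonneg _
  have hMa : ∀ i, a i ∈ Icc (-M) M := fun i => by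
    have : |a i| ≤ ∑ i, |a i| :=
      Finset.single_le_sum (f := fun i => |a i|) (fun i _ => abs_nonneg _) (Finset.mem_univ i)
    exact abs_le.1 (by linarith [norm_nonneg (matrixOp b (realDiagonal a))])
  obtain ⟨q, hq0, hq0', hqb, hq1, hq2⟩ := exists_polynomial_tendsto_mul_abs M
  rw [← closure_closure]
  suffices hT : Tendsto (fun m => matrixOp b (secondOrderMatrix o a v (q m))) atTop
      (𝓝 (matrixOp b (signSecondOrderMatrix o a v))) from
    mem_closure_of_tendsto hT (Eventually.of_forall fun m => secondOrderMatrix_mem_closure b ha ha' hv hs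
      (by linarith : ‖matrixOp b (realDiagonal a)‖ < M) (q m) (hqb m))
  refine tendsto_matrixOp b fun i j => ?_
  simp only [secondOrderMatrix, signSecondOrderMatrix, hq0, hq0', sub_zero, zero_mul]
  split_ifs
  · refine (Complex.continuous_ofReal.tendsto _).comp (tendsto_finsetSum _ fun l _ => ?_)
    exact ((hq2 _ (hMa l)).div_const _).const_mul _
  · exact tendsto_const_nhds
  · refine (Complex.continuous_ofReal.tendsto _).comp (Tendsto.const_mul _ ?_)
    simp only [dividedDiffZero, signDividedDiff, hq0, sub_zero]
    split_ifs
    · exact ((hq1 _ (hMa i)).div_const _).sub ((hq2 _ (hMa i)).div_const _)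
    · exact (((hq2 _ (hMa i)).div_const _).sub ((hq2 _ (hMa j)).div_const _)).div_const _

end Attainable

/-! ### The lacunary limit: the sign kernel -/

theorem signDividedDiff_of_pos {x y : ℝ} (hx : 0 < x) (hy : 0 < y) : signDividedDiff x y = 1 := by
  rw [signDividedDiff, abs_of_pos hx, abs_of_pos hy]
  split_ifs with h
  · field_simp; norm_num
  · have := sub_ne_zero.2 h
    field_simp

theorem signDividedDiff_of_neg {x y : ℝ} (hx : 0 < x) (hy : 0 < y) :
    signDividedDiff (-x) (-y) = -1 := by
  rw [signDividedDiff, abs_neg, abs_neg, abs_of_pos hx, abs_of_pos hy]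
  split_ifs with h
  · field_simp; norm_num
  · have : -x - -y ≠ 0 := sub_ne_zero.2 h
    field_simp
    ring

theorem signDividedDiff_of_pos_of_neg {x y : ℝ} (hx : 0 < x) (hy : 0 < y) :
    signDividedDiff x (-y) = (x - y) / (x + y) := by
  rw [signDividedDiff, abs_neg, abs_of_pos hx, abs_of_pos hy, if_neg (by linarith)]
  have : x - -y ≠ 0 := by linarith
  have : x + y ≠ 0 := by linarith
  field_simp
  ring

theorem signDividedDiff_of_neg_of_pos {x y : ℝ} (hx : 0 < x) (hy : 0 < y) :
    signDividedDiff (-x) y = (y - x) / (y + x) := by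
  rw [signDividedDiff, abs_neg, abs_of_pos hx, abs_of_pos hy, if_neg (by linarith)]
  have : -x - y ≠ 0 := by linarith
  have : x + y ≠ 0 := by linarith
  field_simp
  ring

/-- The larger power dominates: with `d = |i - j| > 0` the quotient is `±(1 - 2 / (β^d + 1))`. This
is where lacunary eigenvalues of opposite sign produce triangular truncation. -/
theorem tendsto_pow_sub_div_pow_add (i j : ℕ) :
    Tendsto (fun β : ℝ => (β ^ (i + 1) - β ^ (j + 1)) / (β ^ (i + 1) + β ^ (j + 1))) atTop
      (𝓝 ((SignType.sign ((i : ℤ) - j) : ℤ) : ℝ)) := by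
  have key : ∀ d : ℕ, d ≠ 0 → Tendsto (fun β : ℝ => 1 - 2 / (β ^ d + 1)) atTop (𝓝 1) := by
    intro d hd
    have h1 : Tendsto (fun β : ℝ => 2 / (β ^ d + 1)) atTop (𝓝 0) :=
      (tendsto_atTop_add_const_right _ 1 (tendsto_pow_atTop hd)).const_div_atTop 2
    simpa using h1.const_sub 1
  rcases lt_trichotomy i j with h | h | h
  · rw [sign_neg (by omega)]
    obtain ⟨d, rfl⟩ := Nat.exists_eq_add_of_lt h
    have h2 := (key (d + 1) (by omega)).neg
    simp only [SignType.coe_neg_one, Int.cast_neg, Int.cast_one]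
    refine h2.congr' ?_
    filter_upwards [eventually_gt_atTop 0] with β hβ
    have h3 : β ^ (i + d + 1 + 1) = β ^ (i + 1) * β ^ (d + 1) := by ring
    rw [h3]
    have h4 : 0 < β ^ (i + 1) := by positivity
    have h5 : 0 < β ^ (d + 1) := by positivity
    generalize β ^ (i + 1) = x at *
    generalize β ^ (d + 1) = y at *
    have : x + x * y ≠ 0 := by positivity
    field_simp
    ring
  · subst h
    simp
  · rw [sign_pos (by omega)]
    obtain ⟨d, rfl⟩ := Nat.exists_eq_add_of_lt h
    have h2 := key (d + 1) (by omega)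
    simp only [SignType.coe_one, Int.cast_one]
    refine h2.congr' ?_
    filter_upwards [eventually_gt_atTop 0] with β hβ
    have h3 : β ^ (j + d + 1 + 1) = β ^ (j + 1) * β ^ (d + 1) := by ring
    rw [h3]
    have h4 : 0 < β ^ (j + 1) := by positivity
    have h5 : 0 < β ^ (d + 1) := by positivity
    generalize β ^ (j + 1) = x at *
    generalize β ^ (d + 1) = y at *
    have : x * y + x ≠ 0 := by positivity
    field_simp
    ring

/-- The eigenvalues `0`, `β ^ (i + 1)` and `-β ^ (i + 1)`. -/
def lacunarySpectrum (n : ℕ) (β : ℝ) : Option (Fin n ⊕ Fin n) → ℝ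
  | none => 0
  | some (.inl i) => β ^ ((i : ℕ) + 1)
  | some (.inr i) => -β ^ ((i : ℕ) + 1)

/-- The unit vector with equal coordinates away from the index `none`. -/
noncomputable def uniformWeight (n : ℕ) : Option (Fin n ⊕ Fin n) → ℝ
  | none => 0
  | some _ => (√(2 * n))⁻¹

/-- The limit of the divided differences of `x |x|` on the points of `lacunarySpectrum n β`. -/
noncomputable def signKernel (n : ℕ) : Option (Fin n ⊕ Fin n) → Option (Fin n ⊕ Fin n) → ℝ
  | some (.inl _), some (.inl _) => 1
  | some (.inr _), some (.inr _) => -1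
  | some (.inl i), some (.inr j) => ((SignType.sign (((i : ℕ) : ℤ) - (j : ℕ)) : ℤ) : ℝ)
  | some (.inr i), some (.inl j) => ((SignType.sign (((j : ℕ) : ℤ) - (i : ℕ)) : ℤ) : ℝ)
  | none, _ => 0
  | some _, none => 0

/-- The matrix with entries `signKernel n x y / (2 n)`. -/
noncomputable def signKernelMatrix (n : ℕ) :
    Matrix (Option (Fin n ⊕ Fin n)) (Option (Fin n ⊕ Fin n)) ℂ :=
  fun x y => (((2 * n : ℝ)⁻¹ * signKernel n x y : ℝ) : ℂ)

theorem sq_inv_sqrt_two_mul (n : ℕ) : (√(2 * n))⁻¹ * (√(2 * n))⁻¹ = (2 * n : ℝ)⁻¹ := by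
  rw [← mul_inv, Real.mul_self_sqrt (by positivity)]

theorem sum_uniformWeight_sq {n : ℕ} (hn : n ≠ 0) : ∑ x, uniformWeight n x ^ 2 = 1 := by
  have : (n : ℝ) ≠ 0 := by exact_mod_cast hn
  simp only [Fintype.sum_option, uniformWeight, sq, sq_inv_sqrt_two_mul]
  simp
  field_simp
  norm_num

theorem tendsto_signDividedDiff_lacunarySpectrum {n : ℕ} (x y : Fin n ⊕ Fin n) :
    Tendsto (fun β => signDividedDiff (lacunarySpectrum n β (some x))
      (lacunarySpectrum n β (some y))) atTop (𝓝 (signKernel n (some x) (some y))) := by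
  rcases x with i | i <;> rcases y with j | j <;> simp only [lacunarySpectrum, signKernel]
  · refine tendsto_const_nhds.congr' ?_
    filter_upwards [eventually_gt_atTop 0] with β hβ
    rw [signDividedDiff_of_pos (by positivity) (by positivity)]
  · refine (tendsto_pow_sub_div_pow_add i j).congr' ?_
    filter_upwards [eventually_gt_atTop 0] with β hβ
    rw [signDividedDiff_of_pos_of_neg (by positivity) (by positivity)]
  · refine (tendsto_pow_sub_div_pow_add j i).congr' ?_
    filter_upwards [eventually_gt_atTop 0] with β hβ
    rw [signDividedDiff_of_neg_of_pos (by positivity) (by positivity)]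
  · refine tendsto_const_nhds.congr' ?_
    filter_upwards [eventually_gt_atTop 0] with β hβ
    rw [signDividedDiff_of_neg (by positivity) (by positivity)]

theorem abs_signKernel_le (n : ℕ) (x y : Option (Fin n ⊕ Fin n)) : |signKernel n x y| ≤ 1 := by
  have h : ∀ s : SignType, |((s : ℤ) : ℝ)| ≤ 1 := by
    intro s
    rcases s <;> simp
  rcases x with - | i | i <;> rcases y with - | j | j <;> simp only [signKernel] <;>
    first | exact h _ | simp

/-- There are `(2n + 1)²` entries of modulus at most `1 / (2n)`, so the sum is at most `4`. The
strict bound `5` leaves room for a perturbation. -/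
theorem sum_norm_sq_signKernelMatrix_lt {n : ℕ} (hn : n ≠ 0) :
    ∑ y, ∑ x, ‖signKernelMatrix n x y‖ ^ 2 < 5 := by
  have hn' : (1 : ℝ) ≤ n := by exact_mod_cast Nat.one_le_iff_ne_zero.2 hn
  have h : ∀ x y, ‖signKernelMatrix n x y‖ ^ 2 ≤ ((2 * n : ℝ)⁻¹) ^ 2 := by
    intro x y
    rw [signKernelMatrix, Complex.norm_real, Real.norm_eq_abs, sq_abs, mul_pow]
    have := (sq_le_one_iff_abs_le_one _).2 (abs_signKernel_le n x y)
    exact mul_le_of_le_one_right (sq_nonneg _) this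
  calc ∑ y, ∑ x, ‖signKernelMatrix n x y‖ ^ 2
      ≤ ∑ _y : Option (Fin n ⊕ Fin n), ∑ _x : Option (Fin n ⊕ Fin n), ((2 * n : ℝ)⁻¹) ^ 2 :=
        Finset.sum_le_sum fun y _ => Finset.sum_le_sum fun x _ => h x y
    _ = ((2 * n + 1) / (2 * n)) ^ 2 := by
        simp only [Finset.sum_const, Finset.card_univ, Fintype.card_option, Fintype.card_sum,
          Fintype.card_fin, nsmul_eq_mul]
        push_cast
        field_simp
        ring
    _ ≤ 2 ^ 2 := by
        gcongr
        rw [div_le_iff₀ (by positivity)]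
        linarith
    _ < 5 := by norm_num

/-! ### Trace norm of the sign kernel through roots of `-1` -/

/-- Splitting at `j = i` gives two geometric sums, equal after multiplication by `w - 1` to `(w^i -
1) - (w^n - w^(i+1))`. The constants cancel exactly because `w ^ n = -1`. -/
theorem sum_sign_sub_mul_pow {n : ℕ} {w : ℂ} (hw : w ^ n = -1) (i : Fin n) :
    (∑ j : Fin n, (((SignType.sign (((i : ℕ) : ℤ) - (j : ℕ)) : ℤ) : ℝ) : ℂ) * w ^ (j : ℕ)) * (w - 1)
      = (1 + w) * w ^ (i : ℕ) := by
  rw [Fin.sum_univ_eq_sum_range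
    (fun j => (((SignType.sign (((i : ℕ) : ℤ) - (j : ℕ)) : ℤ) : ℝ) : ℂ) * w ^ (j : ℕ)) n,
    Finset.range_eq_Ico, ← Finset.sum_Ico_consecutive _ (Nat.zero_le _) i.2.le,
    Finset.sum_eq_sum_Ico_succ_bot i.2, ← Finset.range_eq_Ico]
  have h1 : ∑ j ∈ Finset.range i,
      (((SignType.sign (((i : ℕ) : ℤ) - (j : ℕ)) : ℤ) : ℝ) : ℂ) * w ^ j
      = ∑ j ∈ Finset.range i, w ^ j := by
    refine Finset.sum_congr rfl fun j hj => ?_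
    have := Finset.mem_range.1 hj
    rw [sign_pos (by omega)]
    simp
  have h2 : ∑ j ∈ Finset.Ico ((i : ℕ) + 1) n,
      (((SignType.sign (((i : ℕ) : ℤ) - (j : ℕ)) : ℤ) : ℝ) : ℂ) * w ^ j
      = -∑ j ∈ Finset.Ico ((i : ℕ) + 1) n, w ^ j := by
    rw [← Finset.sum_neg_distrib]
    refine Finset.sum_congr rfl fun j hj => ?_
    have := Finset.mem_Ico.1 hj
    rw [sign_neg (by omega)]
    simp
  rw [h1, h2]
  simp only [sub_self, sign_zero, SignType.coe_zero, Int.cast_zero, Complex.ofReal_zero, zero_mul,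
    zero_add]
  rw [add_mul, neg_mul, geom_sum_mul, geom_sum_Ico_mul _ i.2, hw, Nat.succ_eq_add_one, pow_succ]
  ring

/-- Coordinates of the test vectors. -/
noncomputable def testCoord (n : ℕ) (w : ℂ) : Option (Fin n ⊕ Fin n) → ℂ
  | none => 0
  | some (.inl j) => ((√(2 * n))⁻¹ : ℝ) * w ^ (j : ℕ)
  | some (.inr j) => ((√(2 * n))⁻¹ : ℝ) * (Complex.I * w ^ (j : ℕ))

variable {V : Type*} [NormedAddCommGroup V] [InnerProductSpace ℂ V]

/-- The vector with coordinates `testCoord n w`. -/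
noncomputable def testVector {n : ℕ} (b : OrthonormalBasis (Option (Fin n ⊕ Fin n)) ℂ V) (w : ℂ) :
    V := b.repr.symm (WithLp.toLp 2 (testCoord n w))

theorem repr_testVector {n : ℕ} (b : OrthonormalBasis (Option (Fin n ⊕ Fin n)) ℂ V) (w : ℂ)
    (x : Option (Fin n ⊕ Fin n)) : b.repr (testVector b w) x = testCoord n w x := by
  simp [testVector]

theorem inner_testVector {n : ℕ} (b : OrthonormalBasis (Option (Fin n ⊕ Fin n)) ℂ V) (w z : ℂ) :
    inner ℂ (testVector b w) (testVector b z) =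
      (n : ℂ)⁻¹ * ∑ j ∈ Finset.range n, (star w * z) ^ j := by
  have h : ((√(2 * n))⁻¹ : ℝ) * (((√(2 * n))⁻¹ : ℝ) : ℂ) = (2 * n : ℂ)⁻¹ := by
    rw [← Complex.ofReal_mul, sq_inv_sqrt_two_mul]
    push_cast
    rfl
  rw [← b.repr.inner_map_map, PiLp.inner_apply, Fintype.sum_option, Fintype.sum_sum_type]
  simp only [repr_testVector, testCoord, RCLike.inner_apply]
  have h1 : ∀ j : Fin n, ((√(2 * n))⁻¹ : ℝ) * z ^ (j : ℕ) *
      (starRingEnd ℂ) (((√(2 * n))⁻¹ : ℝ) * w ^ (j : ℕ)) =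
      (2 * n : ℂ)⁻¹ * (star w * z) ^ (j : ℕ) := by
    intro j
    rw [← h, map_mul, Complex.conj_ofReal, map_pow, mul_pow]
    simp only [RCLike.star_def]
    ring
  have h2 : ∀ j : Fin n, ((√(2 * n))⁻¹ : ℝ) * (Complex.I * z ^ (j : ℕ)) *
      (starRingEnd ℂ) (((√(2 * n))⁻¹ : ℝ) * (Complex.I * w ^ (j : ℕ))) =
      (2 * n : ℂ)⁻¹ * (star w * z) ^ (j : ℕ) := by
    intro j
    rw [← h, map_mul, map_mul, Complex.conj_ofReal, map_pow, mul_pow, Complex.conj_I]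
    simp only [RCLike.star_def]
    linear_combination (-((√(2 * n))⁻¹ : ℝ) * z ^ (j : ℕ) *
      ((((√(2 * n))⁻¹ : ℝ) * (starRingEnd ℂ) w ^ (j : ℕ)))) * Complex.I_mul_I
  simp only [h1, h2]
  rw [← Fin.sum_univ_eq_sum_range (fun j => (star w * z) ^ j) n, ← Finset.mul_sum, mul_inv]
  simp
  ring

variable [CompleteSpace V]

theorem signKernelMatrix_mem_closure {n : ℕ} (hn : n ≠ 0)
    (b : OrthonormalBasis (Option (Fin n ⊕ Fin n)) ℂ V) :
    matrixOp b (signKernelMatrix n) ∈ closure (normalizedRemainders b) := by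
  rw [← closure_closure]
  have hT : Tendsto (fun β => matrixOp b
      (signSecondOrderMatrix none (lacunarySpectrum n β) (uniformWeight n))) atTop
      (𝓝 (matrixOp b (signKernelMatrix n))) := by
    refine tendsto_matrixOp b fun x y => ?_
    rcases y with - | y
    · rcases x with - | x
      -- The corner entry is zero because the contributions of `β^(i+1)` and `-β^(i+1)` cancel:
      -- `a|a| / a²` is odd and the weights are equal.
      · refine tendsto_const_nhds.congr' ?_
        filter_upwards [eventually_gt_atTop 0] with β hβ
        simp only [signKernelMatrix, signKernel, signSecondOrderMatrix, if_true, Fintype.sum_option,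
          Fintype.sum_sum_type, lacunarySpectrum, uniformWeight]
        congr 1
        simp only [abs_neg, neg_sq, neg_mul, neg_div, mul_neg, Finset.sum_neg_distrib]
        simp
      · simp [signKernelMatrix, signKernel, signSecondOrderMatrix]
    · simp only [signKernelMatrix, signSecondOrderMatrix, reduceCtorEq, if_false]
      rcases x with - | x
      · simp [signKernel, uniformWeight]
      · refine (Complex.continuous_ofReal.tendsto _).comp ?_
        simp only [uniformWeight, sq_inv_sqrt_two_mul]
        exact (tendsto_signDividedDiff_lacunarySpectrum x y).const_mul _
  refine mem_closure_of_tendsto hT ?_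
  filter_upwards [eventually_gt_atTop 0] with β hβ
  refine signSecondOrderMatrix_mem_closure b rfl ?_ rfl (sum_uniformWeight_sq hn)
  rintro (- | i | i) hi
  · exact absurd rfl hi
  · exact (pow_pos hβ _).ne'
  · exact (neg_neg_of_pos (pow_pos hβ _)).ne

/-- The factor `I` on the second half of the test vector makes the two constant diagonal blocks
cancel and the two antisymmetric sign blocks add up, leaving twice the sign kernel, for which the
powers of `w` form an eigenvector. -/
theorem inner_testVector_matrixOp {n : ℕ} (hn : n ≠ 0)
    (b : OrthonormalBasis (Option (Fin n ⊕ Fin n)) ℂ V) {w : ℂ} (hw : w ^ n = -1)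
    (hw1 : ‖w‖ = 1) :
    inner ℂ (testVector b w) (matrixOp b (signKernelMatrix n) (testVector b w)) * (w - 1) =
      Complex.I * (1 + w) / (2 * n) := by
  have h : ((√(2 * n))⁻¹ : ℝ) * (((√(2 * n))⁻¹ : ℝ) : ℂ) = (2 * n : ℂ)⁻¹ := by
    rw [← Complex.ofReal_mul, sq_inv_sqrt_two_mul]
    push_cast
    rfl
  have hn' : (n : ℂ) ≠ 0 := by exact_mod_cast hn
  have hs : ∀ i j : ℕ, (((SignType.sign ((j : ℤ) - (i : ℕ)) : ℤ) : ℝ) : ℂ) =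
      -(((SignType.sign ((i : ℤ) - (j : ℕ)) : ℤ) : ℝ) : ℂ) := by
    intro i j
    rw [← neg_sub, Left.sign_neg]
    simp
  rw [inner_matrixOp]
  simp only [repr_testVector, Fintype.sum_option, Fintype.sum_sum_type, testCoord, signKernelMatrix,
    signKernel, star_zero, zero_mul, mul_zero, Finset.sum_const_zero, zero_add,
    ← Finset.sum_add_distrib]
  have h3 : ∀ i j : Fin n,
      star (((√(2 * n))⁻¹ : ℝ) * w ^ (i : ℕ)) *
        (((2 * n : ℝ)⁻¹ * 1 : ℝ) : ℂ) * (((√(2 * n))⁻¹ : ℝ) * w ^ (j : ℕ)) +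
      star (((√(2 * n))⁻¹ : ℝ) * w ^ (i : ℕ)) *
        (((2 * n : ℝ)⁻¹ * ((SignType.sign (((i : ℕ) : ℤ) - (j : ℕ)) : ℤ) : ℝ) : ℝ) : ℂ) *
          (((√(2 * n))⁻¹ : ℝ) * (Complex.I * w ^ (j : ℕ))) +
      (star (((√(2 * n))⁻¹ : ℝ) * (Complex.I * w ^ (i : ℕ))) *
        (((2 * n : ℝ)⁻¹ * ((SignType.sign (((j : ℕ) : ℤ) - (i : ℕ)) : ℤ) : ℝ) : ℝ) : ℂ) *
          (((√(2 * n))⁻¹ : ℝ) * w ^ (j : ℕ)) +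
      star (((√(2 * n))⁻¹ : ℝ) * (Complex.I * w ^ (i : ℕ))) *
        (((2 * n : ℝ)⁻¹ * -1 : ℝ) : ℂ) * (((√(2 * n))⁻¹ : ℝ) * (Complex.I * w ^ (j : ℕ)))) =
      (2 * (2 * n : ℂ)⁻¹ * (2 * n : ℂ)⁻¹ * Complex.I * star (w ^ (i : ℕ))) *
        ((((SignType.sign (((i : ℕ) : ℤ) - (j : ℕ)) : ℤ) : ℝ) : ℂ) * w ^ (j : ℕ)) := by
    intro i j
    rw [star_mul, star_mul, star_mul, RCLike.star_def, Complex.conj_ofReal, Complex.conj_I,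
      ← RCLike.star_def]
    simp only [Complex.ofReal_mul]
    rw [hs i j, ← h]
    generalize star (w ^ (i : ℕ)) = p
    generalize w ^ (j : ℕ) = r
    generalize (((SignType.sign (((i : ℕ) : ℤ) - (j : ℕ)) : ℤ) : ℝ) : ℂ) = s
    rw [show (((2 * n : ℝ)⁻¹ : ℝ) : ℂ) = ((√(2 * n))⁻¹ : ℝ) * (((√(2 * n))⁻¹ : ℝ) : ℂ) by
      rw [h]; push_cast; rfl]
    generalize (((√(2 * n))⁻¹ : ℝ) : ℂ) = c
    push_cast
    linear_combination (c ^ 4 * p * r) * Complex.I_mul_I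
  have h4 : ∀ i : Fin n, (2 * (2 * n : ℂ)⁻¹ * (2 * n : ℂ)⁻¹ * Complex.I * star (w ^ (i : ℕ))) *
      ((1 + w) * w ^ (i : ℕ)) = (2 * n : ℂ)⁻¹ * (Complex.I * (1 + w)) * (n : ℂ)⁻¹ := by
    intro i
    have hwi : star (w ^ (i : ℕ)) * w ^ (i : ℕ) = 1 := by
      rw [RCLike.star_def, Complex.conj_mul', norm_pow, hw1]
      simp
    rw [mul_inv]
    linear_combination ((2 : ℂ)⁻¹ * (n : ℂ)⁻¹ * Complex.I * (1 + w) * (n : ℂ)⁻¹) * hwi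
  simp only [h3, ← Finset.mul_sum]
  rw [Finset.sum_mul]
  simp only [mul_assoc _ (∑ j : Fin n, _) (w - 1), sum_sign_sub_mul_pow hw, h4]
  simp
  field_simp

theorem exists_mem_normalizedRemainders_le_sum {n m : ℕ} (hnm : n = 4 * m)
    (hm : m ≠ 0) (b : OrthonormalBasis (Option (Fin n ⊕ Fin n)) ℂ V) {K : ℝ}
    (hK : K < ∑ k ∈ Finset.range m, (2 * π * (2 * k + 1))⁻¹) :
    ∃ X ∈ normalizedRemainders b, ∃ u : Fin m → V, Orthonormal ℂ u ∧
      ∑ i, ‖X (b i)‖ ^ 2 < 5 ∧ K < ∑ k, ‖inner ℂ (u k) (X (u k))‖ := by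
  have hn : n ≠ 0 := by omega
  have hnR : (0 : ℝ) < n := by exact_mod_cast Nat.pos_of_ne_zero hn
  have hnC : (n : ℂ) ≠ 0 := by exact_mod_cast hn
  -- The numbers `exp (I θ k)` are `n`-th roots of `-1`. The ratio of two distinct ones is an `n`-th
  -- root of unity other than `1`, hence the orthogonality of the test vectors.
  let θ : ℕ → ℝ := fun k => π * (2 * k + 1) / n
  let w : ℕ → ℂ := fun k => Complex.exp (Complex.I * θ k)
  have hwn : ∀ k, w k ^ n = -1 := by
    intro k
    rw [← Complex.exp_nat_mul, show (n : ℂ) * (Complex.I * θ k) =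
      π * Complex.I + k * (2 * π * Complex.I) by
        simp only [θ]; push_cast; field_simp; ring,
      Complex.exp_periodic.nat_mul k, Complex.exp_pi_mul_I]
  have hw1 : ∀ k, ‖w k‖ = 1 := fun k => by
    simp only [w]
    rw [mul_comm, Complex.norm_exp_ofReal_mul_I]
  have hunit : ∀ k, star (w k) * w k = 1 := fun k => by
    rw [RCLike.star_def, Complex.conj_mul', hw1]
    simp
  let u : Fin m → V := fun k => testVector b (w k)
  have hu : Orthonormal ℂ u := by
    rw [orthonormal_iff_ite]
    intro k l
    simp only [u, inner_testVector]
    split_ifs with hkl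
    · subst hkl
      rw [hunit]
      simp [hnC]
    · have hz1 : star (w k) * w l ≠ 1 := by
        intro h1
        have h2 : w l = w k := by
          calc w l = (star (w k) * w k) * w l := by rw [hunit, one_mul]
            _ = (star (w k) * w l) * w k := by ring
            _ = w k := by rw [h1, one_mul]
        obtain ⟨N, hN⟩ := Complex.exp_eq_exp_iff_exists_int.1 h2
        have h3 : (2 * (l : ℕ) + 1 : ℂ) = (2 * (k : ℕ) + 1) + N * (2 * n) := by
          simp only [θ] at hN
          push_cast at hN
          have hpi : (π : ℂ) ≠ 0 := by exact_mod_cast Real.pi_ne_zero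
          field_simp at hN
          linear_combination hN
        have h4 : (2 * ((l : ℕ) : ℤ) + 1) = (2 * (k : ℕ) + 1) + N * (2 * n) := by exact_mod_cast h3
        have h5 : ((l : ℕ) : ℤ) - (k : ℕ) = N * n := by linarith
        have h6 : N = 0 := by
          have := k.2
          have := l.2
          rcases lt_trichotomy N 0 with h | h | h
          · nlinarith
          · exact h
          · nlinarith
        rw [h6] at h5
        exact hkl (Fin.ext (by omega))
      have hzn : (star (w k) * w l) ^ n = 1 := by
        rw [mul_pow, ← star_pow, hwn, hwn]
        simp
      have := geom_sum_mul (star (w k) * w l) n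
      rw [hzn, sub_self] at this
      rw [(mul_eq_zero.1 this).resolve_right (sub_ne_zero.2 hz1), mul_zero]
  have hlow : ∀ k : Fin m, (2 * π * (2 * ((k : ℕ) : ℝ) + 1))⁻¹ ≤
      ‖inner ℂ (u k) (matrixOp b (signKernelMatrix n) (u k))‖ := by
    intro k
    have h1 := congrArg norm (inner_testVector_matrixOp hn b (hwn k) (hw1 k))
    have hθ0 : 0 < θ k := by simp only [θ]; positivity
    -- Only the first `m = n / 4` roots are kept, so that `‖1 + w k‖ ≥ 1`; with `‖w k - 1‖ ≤ θ k`
    -- each diagonal entry is at least `1 / (2 n θ k)`.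
    have hθ : θ k ≤ π / 2 := by
      simp only [θ]
      have : (k : ℝ) + 1 ≤ m := by exact_mod_cast k.2
      have hn4 : (n : ℝ) = 4 * m := by rw [hnm]; push_cast; rfl
      rw [div_le_div_iff₀ hnR two_pos, mul_assoc]
      exact mul_le_mul_of_nonneg_left (by rw [hn4]; linarith) Real.pi_pos.le
    have h2 : ‖w k - 1‖ ≤ θ k := by
      have := Real.norm_exp_I_mul_ofReal_sub_one_le (x := θ k)
      rwa [Real.norm_eq_abs, abs_of_pos hθ0] at this
    have h3 : 1 ≤ ‖1 + w k‖ := by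
      have h4 : (1 + w k).re = 1 + Real.cos (θ k) := by
        simp only [w]
        rw [mul_comm, Complex.add_re, Complex.one_re, Complex.exp_ofReal_mul_I_re]
      have h5 := Real.cos_nonneg_of_neg_pi_div_two_le_of_le (x := θ k) (by linarith [Real.pi_pos]) hθ
      calc (1 : ℝ) ≤ (1 + w k).re := by rw [h4]; linarith
        _ ≤ _ := Complex.re_le_norm _
    rw [norm_mul, norm_div, norm_mul, Complex.norm_I, one_mul] at h1
    have h4 : ‖(2 * n : ℂ)‖ = 2 * n := by simp
    rw [h4] at h1
    have h5 : (2 * n : ℝ)⁻¹ ≤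
        ‖inner ℂ (u k) (matrixOp b (signKernelMatrix n) (u k))‖ * θ k := by
      calc (2 * n : ℝ)⁻¹ ≤ ‖1 + w k‖ / (2 * n) := by
            rw [inv_eq_one_div]; gcongr
        _ = _ := h1.symm
        _ ≤ _ := mul_le_mul_of_nonneg_left h2 (norm_nonneg _)
    rw [← div_le_iff₀ hθ0] at h5
    refine le_trans (le_of_eq ?_) h5
    simp only [θ]
    field_simp
  -- Both requirements are open in `X`, so they pass from the limit matrix to a genuine normalized
  -- remainder. The diagonal sum over an orthonormal family replaces the trace norm.
  have hopen : IsOpen {X : V →L[ℂ] V | ∑ i, ‖X (b i)‖ ^ 2 < 5 ∧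
      K < ∑ k, ‖inner ℂ (u k) (X (u k))‖} := by
    have c1 : Continuous fun X : V →L[ℂ] V => ∑ i, ‖X (b i)‖ ^ 2 := by fun_prop
    have c2 : Continuous fun X : V →L[ℂ] V => ∑ k, ‖inner ℂ (u k) (X (u k))‖ := by fun_prop
    exact (isOpen_lt c1 continuous_const).inter (isOpen_lt continuous_const c2)
  obtain ⟨X, hX, hXm⟩ := mem_closure_iff.1 (signKernelMatrix_mem_closure hn b) _ hopen
    ⟨by rw [sum_norm_sq_matrixOp]; exact sum_norm_sq_signKernelMatrix_lt hn, by
      refine hK.trans_le ?_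
      rw [← Fin.sum_univ_eq_sum_range (fun k => (2 * π * (2 * (k : ℝ) + 1))⁻¹) m]
      exact Finset.sum_le_sum fun k _ => hlow k⟩
  exact ⟨X, hXm, u, hu, hX.1, hX.2⟩

theorem exists_lt_sum_range_inv_odd (K : ℝ) :
    ∃ m : ℕ, m ≠ 0 ∧ K < ∑ k ∈ Finset.range m, (2 * π * (2 * k + 1))⁻¹ := by
  have h := Real.tendsto_sum_range_one_div_nat_succ_atTop.const_mul_atTop
    (show (0 : ℝ) < (4 * π)⁻¹ by positivity)
  obtain ⟨m, hm, hm0⟩ := ((h.eventually_gt_atTop K).and (eventually_ne_atTop 0)).exists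
  refine ⟨m, hm0, hm.trans_le ?_⟩
  rw [Finset.mul_sum]
  refine Finset.sum_le_sum fun k _ => ?_
  rw [one_div, ← mul_inv]
  refine inv_anti₀ (by positivity) ?_
  nlinarith [Real.pi_pos]

/-- Finite-dimensional blocks with Taylor remainders of large trace norm. -/
theorem exists_block (K : ℝ) : ∃ (d n m : ℕ)
    (b : OrthonormalBasis (Option (Fin n ⊕ Fin n)) ℂ (EuclideanSpace ℂ (Fin d))),
    ∃ X ∈ normalizedRemainders b, ∃ u : Fin m → EuclideanSpace ℂ (Fin d), Orthonormal ℂ u ∧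
      ∑ i, ‖X (b i)‖ ^ 2 < 5 ∧ K < ∑ k, ‖inner ℂ (u k) (X (u k))‖ := by
  obtain ⟨m, hm, hK⟩ := exists_lt_sum_range_inv_odd K
  let e := Fintype.equivFin (Option (Fin (4 * m) ⊕ Fin (4 * m)))
  let b := (EuclideanSpace.basisFun (Fin _) ℂ).reindex e.symm
  exact ⟨_, _, m, b, exists_mem_normalizedRemainders_le_sum rfl hm b hK⟩

/-! ### Transfer from polynomials to the functional calculus -/

section Block

variable {V : Type*} [NormedAddCommGroup V] [InnerProductSpace ℂ V] [CompleteSpace V]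

theorem spectrum_subset_Icc_of_norm_le {X : V →L[ℂ] V} {M : ℝ} (hM : ‖X‖ ≤ M) :
    spectrum ℝ X ⊆ Icc (-M) M := by
  intro x hx
  have h1 := spectrum.norm_le_norm_mul_of_mem hx
  have h2 : ‖(1 : V →L[ℂ] V)‖ ≤ 1 := ContinuousLinearMap.norm_id_le
  have h3 : |x| ≤ M := by
    calc |x| = ‖x‖ := (Real.norm_eq_abs x).symm
      _ ≤ ‖X‖ * ‖(1 : V →L[ℂ] V)‖ := h1
      _ ≤ ‖X‖ * 1 := by gcongr
      _ ≤ M := by rwa [mul_one]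
  exact abs_le.1 h3

theorem cfc_add_smul_eq_aeval {f : ℝ → ℝ} (hf : Continuous f) {q : Polynomial ℝ}
    {c r M α β : ℝ} (hq : ∀ x ∈ Icc (-M) M, f (c + r * x) = r ^ 2 * q.eval x + α + β * x)
    {X : V →L[ℂ] V} (hX : IsSelfAdjoint X) (hM : ‖X‖ ≤ M) :
    cfc f ((c : ℂ) • 1 + (r : ℂ) • X) = r ^ 2 • Polynomial.aeval X q + α • 1 + β • X := by
  have h1 : (c : ℂ) • (1 : V →L[ℂ] V) + (r : ℂ) • X = cfc (fun x => c + r * x) X := by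
    have := cfc_polynomial (.C c + .C r * .X : Polynomial ℝ) X hX
    simp only [Polynomial.eval_add, Polynomial.eval_C, Polynomial.eval_mul,
      Polynomial.eval_X] at this
    simp only [this, map_add, map_mul, Polynomial.aeval_C, Polynomial.aeval_X,
      Algebra.algebraMap_eq_smul_one, smul_mul_assoc, one_mul, Complex.coe_smul]
  have h2 := cfc_polynomial (.C (r ^ 2) * q + .C α + .C β * .X : Polynomial ℝ) X hX
  simp only [Polynomial.eval_add, Polynomial.eval_C, Polynomial.eval_mul,
      Polynomial.eval_X, map_add, map_mul, Polynomial.aeval_C, Polynomial.aeval_X,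
      Algebra.algebraMap_eq_smul_one, smul_mul_assoc, one_mul] at h2
  rw [h1, ← h2, ← cfc_comp' f (fun x => c + r * x) X hf.continuousOn (by fun_prop) hX]
  exact cfc_congr fun x hx => hq x (spectrum_subset_Icc_of_norm_le hM hx)

variable {f : ℝ → ℝ} {q : Polynomial ℝ} {c r M α β : ℝ} {A B D : V →L[ℂ] V}

/-- For small `s` the spectrum of `A + s B` stays in `[-M, M]`, where `f` composed with the scaling
is a polynomial. The curve is therefore locally polynomial in `s`. -/
theorem hasDerivAt_cfc_of_eq_polynomial (hf : Continuous f)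
    (hq : ∀ x ∈ Icc (-M) M, f (c + r * x) = r ^ 2 * q.eval x + α + β * x)
    (hA : IsSelfAdjoint A) (hB : IsSelfAdjoint B) (hM : ‖A‖ + ‖B‖ < M)
    (hD : HasDerivAt (fun s : ℝ => Polynomial.aeval (A + (s : ℂ) • B) q) D 0) :
    HasDerivAt (fun t : ℝ => cfc f (((c : ℂ) • 1 + (r : ℂ) • A) + (t : ℂ) • (r : ℂ) • B))
      (r ^ 2 • D + β • B) 0 := by
  have h1 : HasDerivAt (fun s : ℝ => r ^ 2 • Polynomial.aeval (A + (s : ℂ) • B) q + α • 1 +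
      β • (A + (s : ℂ) • B)) (r ^ 2 • D + β • B) 0 := by
    have h2 : HasDerivAt (fun s : ℝ => A + (s : ℂ) • B) B 0 := by
      simp only [Complex.coe_smul]
      simpa using ((hasDerivAt_id (0 : ℝ)).smul_const B).const_add A
    exact ((hD.const_smul (r ^ 2)).add_const _).add (h2.const_smul β)
  refine h1.congr_of_eventuallyEq ?_
  have h3 : ∀ᶠ s : ℝ in 𝓝 0, ‖A‖ + |s| * ‖B‖ < M := by
    have : Continuous fun s : ℝ => ‖A‖ + |s| * ‖B‖ := by fun_prop
    refine (this.tendsto 0).eventually_lt_const ?_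
    simp only [abs_zero, zero_mul, add_zero]
    linarith [norm_nonneg B]
  filter_upwards [h3] with s hs
  have hX : IsSelfAdjoint (A + (s : ℂ) • B) := by
    rw [Complex.coe_smul]
    exact hA.add (isSelfAdjoint_real_smul hB s)
  have hXM : ‖A + (s : ℂ) • B‖ ≤ M := by
    refine (norm_add_le _ _).trans ?_
    rw [norm_smul, Complex.norm_real, Real.norm_eq_abs]
    exact hs.le
  rw [← cfc_add_smul_eq_aeval hf hq hX hXM]
  congr 1
  rw [smul_add, smul_comm (s : ℂ), add_assoc]

/-- An affine function has zero Taylor remainder, so `α` and `β` disappear and only the factor `r ^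
2` is left. -/
theorem taylorRemainder_of_eq_polynomial (hf : Continuous f)
    (hq : ∀ x ∈ Icc (-M) M, f (c + r * x) = r ^ 2 * q.eval x + α + β * x)
    (hA : IsSelfAdjoint A) (hB : IsSelfAdjoint B) (hM : ‖A‖ + ‖B‖ < M)
    (hD : HasDerivAt (fun s : ℝ => Polynomial.aeval (A + (s : ℂ) • B) q) D 0) :
    taylorRemainder f ((c : ℂ) • 1 + (r : ℂ) • A) ((r : ℂ) • B) =
      r ^ 2 • (Polynomial.aeval (A + B) q - Polynomial.aeval A q - D) := by
  rw [taylorRemainder, (hasDerivAt_cfc_of_eq_polynomial hf hq hA hB hM hD).deriv, add_assoc,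
    ← smul_add, cfc_add_smul_eq_aeval hf hq (hA.add hB) ((norm_add_le _ _).trans hM.le),
    cfc_add_smul_eq_aeval hf hq hA (by linarith [norm_nonneg B])]
  module

theorem isSelfAdjoint_deriv {g : ℝ → V →L[ℂ] V} (hg : ∀ t, IsSelfAdjoint (g t)) (x : ℝ) :
    IsSelfAdjoint (deriv g x) := by
  by_cases h : DifferentiableAt ℝ g x
  · have hc : IsClosed {X : V →L[ℂ] V | star X = X} := isClosed_eq continuous_star continuous_id
    exact hc.mem_of_tendsto (hasDerivAt_iff_tendsto_slope_zero.1 h.hasDerivAt)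
      (Eventually.of_forall fun t => isSelfAdjoint_real_smul ((hg _).sub (hg _)) _)
  -- The default value `0` of `deriv` is self-adjoint as well, so no differentiability assumption is
  -- needed.
  · rw [deriv_zero_of_not_differentiableAt h]
    exact IsSelfAdjoint.zero _

theorem isSelfAdjoint_taylorRemainder (f : ℝ → ℝ) (A B : V →L[ℂ] V) :
    IsSelfAdjoint (taylorRemainder f A B) := by
  have h : ∀ X : V →L[ℂ] V, IsSelfAdjoint (cfc f X) := fun X => cfc_predicate f X
  exact ((h _).sub (h _)).sub (isSelfAdjoint_deriv (fun _ => h _) 0)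

end Block

/-! ### Direct sums of blocks -/

section DirectSum

variable {G : ℕ → Type*} [∀ n, NormedAddCommGroup (G n)] [∀ n, InnerProductSpace ℂ (G n)]

theorem exists_isDirectSum {S : ∀ n, G n →L[ℂ] G n} {C : ℝ} (hS : ∀ n, ‖S n‖ ≤ C) :
    ∃ T : HilbertSum G →L[ℂ] HilbertSum G, IsDirectSum T S := by
  have hC : 0 ≤ C := (norm_nonneg (S 0)).trans (hS 0)
  have hb : ∀ (ξ : HilbertSum G) n, ‖S n (ξ n)‖ ≤ ‖((C : ℂ) • ξ : HilbertSum G) n‖ := by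
    intro ξ n
    rw [lp.coeFn_smul, Pi.smul_apply, norm_smul, Complex.norm_real, Real.norm_of_nonneg hC]
    exact (S n).le_of_opNorm_le (hS n) _
  have hm : ∀ ξ : HilbertSum G, Memℓp (fun n => S n (ξ n)) 2 := fun ξ => by
    have h := (lp.memℓp ((C : ℂ) • ξ : HilbertSum G)).summable (by norm_num)
    exact memℓp_gen (Summable.of_nonneg_of_le (fun n => by positivity)
      (fun n => Real.rpow_le_rpow (norm_nonneg _) (hb ξ n) (by norm_num)) h)
  let L : HilbertSum G →ₗ[ℂ] HilbertSum G :=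
    (directSumOp S).toFun.comp (LinearMap.id.codRestrict _ hm)
  have hL : ∀ ξ n, L ξ n = S n (ξ n) := fun ξ n => rfl
  have hn : ∀ ξ, ‖L ξ‖ ≤ C * ‖ξ‖ := fun ξ => by
    have := lp.norm_mono (p := 2) (by norm_num) (x := L ξ) (y := ((C : ℂ) • ξ : HilbertSum G))
      (hb ξ)
    rwa [norm_smul, Complex.norm_real, Real.norm_of_nonneg hC] at this
  exact ⟨L.mkContinuous C hn, hL⟩

variable {T : HilbertSum G →L[ℂ] HilbertSum G} {S : ∀ n, G n →L[ℂ] G n}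

theorem IsDirectSum.apply_single (hT : IsDirectSum T S) (n : ℕ) (x : G n) :
    T (lp.single 2 n x) = lp.single 2 n (S n x) := by
  ext k
  rw [hT]
  rcases eq_or_ne k n with rfl | h
  · simp
  · rw [lp.single_apply_ne _ _ _ h, lp.single_apply_ne _ _ _ h, map_zero]

theorem directSumOp_apply (A : ∀ n, G n →L[ℂ] G n) (ξ : (directSumOp A).domain) (n : ℕ) :
    (directSumOp A ξ) n = A n ((ξ : HilbertSum G) n) := rfl

theorem mem_directSumOp_domain {A : ∀ n, G n →L[ℂ] G n} {ξ : HilbertSum G} :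
    ξ ∈ (directSumOp A).domain ↔ Memℓp (fun n => A n (ξ n)) 2 := Iff.rfl

theorem single_mem_directSumOp_domain (A : ∀ n, G n →L[ℂ] G n) (n : ℕ) (x : G n) :
    lp.single 2 n x ∈ (directSumOp A).domain := by
  have h : (fun k => A k ((lp.single 2 n x : HilbertSum G) k)) =
      (lp.single 2 n (A n x) : HilbertSum G) := by
    funext k
    rcases eq_or_ne k n with rfl | h
    · simp
    · rw [lp.single_apply_ne _ _ _ h, lp.single_apply_ne _ _ _ h, map_zero]
  rw [mem_directSumOp_domain, h]
  exact lp.memℓp _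

theorem directSumOp_single (A : ∀ n, G n →L[ℂ] G n) (n : ℕ) (x : G n) :
    directSumOp A ⟨lp.single 2 n x, single_mem_directSumOp_domain A n x⟩ =
      lp.single 2 n (A n x) := by
  ext k
  rw [directSumOp_apply]
  rcases eq_or_ne k n with rfl | h
  · simp
  · rw [lp.single_apply_ne _ _ _ h, lp.single_apply_ne _ _ _ h, map_zero]

theorem dense_directSumOp_domain (A : ∀ n, G n →L[ℂ] G n) :
    Dense ((directSumOp A).domain : Set (HilbertSum G)) := by
  intro ξ
  exact mem_closure_of_tendsto (lp.hasSum_single (by norm_num) ξ)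
    (Eventually.of_forall fun s =>
      Submodule.sum_mem _ fun n _ => single_mem_directSumOp_domain A n (ξ n))

theorem not_isBoundedOp_directSumOp {A : ∀ n, G n →L[ℂ] G n} (hG : ∀ n, Nontrivial (G n))
    (hA : ∀ (n : ℕ) x, (n : ℝ) * ‖x‖ ≤ ‖A n x‖) : ¬ IsBoundedOp (directSumOp A) := by
  rintro ⟨C, hC⟩
  obtain ⟨n, hn⟩ := exists_nat_gt C
  obtain ⟨x, hx⟩ := exists_ne (0 : G n)
  have h := hC ⟨lp.single 2 n x, single_mem_directSumOp_domain A n x⟩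
  rw [directSumOp_single, lp.norm_single (by norm_num), Submodule.coe_norm,
    lp.norm_single (by norm_num)] at h
  have := (hA n x).trans h
  exact absurd (le_of_mul_le_mul_right this (norm_pos_iff.2 hx)) (not_le.2 hn)

variable [∀ n, CompleteSpace (G n)]

/-- Testing the adjoint against vectors supported in one block identifies its components as `A n (y
n)`. Their square-summability is precisely the domain condition of `directSumOp`. -/
theorem isSelfAdjoint_directSumOp {A : ∀ n, G n →L[ℂ] G n} (hA : ∀ n, IsSelfAdjoint (A n)) :
    IsSelfAdjoint (directSumOp A) := by
  have hd := dense_directSumOp_domain A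
  have hs : ∀ n x y, inner ℂ (A n x) y = inner ℂ x (A n y) := fun n =>
    ContinuousLinearMap.isSelfAdjoint_iff_isSymmetric.1 (hA n)
  rw [LinearPMap.isSelfAdjoint_def]
  have hval : ∀ (y : (directSumOp A).adjoint.domain) n,
      ((directSumOp A).adjoint y) n = A n ((y : HilbertSum G) n) := by
    intro y n
    refine ext_inner_right ℂ fun x => ?_
    have h := LinearPMap.adjoint_isFormalAdjoint hd y
      ⟨lp.single 2 n x, single_mem_directSumOp_domain A n x⟩
    rw [directSumOp_single, lp.inner_single_right, lp.inner_single_right] at h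
    rw [h, hs]
  refine le_antisymm (And.intro (fun y hy => ?_) fun y z hyz => ?_)
    (LinearPMap.IsFormalAdjoint.le_adjoint hd ?_)
  · rw [mem_directSumOp_domain]
    have := lp.memℓp ((directSumOp A).adjoint ⟨y, hy⟩)
    rwa [show (((directSumOp A).adjoint ⟨y, hy⟩ : HilbertSum G) : ∀ n, G n) =
      fun n => A n (y n) from funext (hval ⟨y, hy⟩)] at this
  · ext n
    rw [hval, directSumOp_apply, hyz]
  · intro x y
    rw [lp.inner_eq_tsum, lp.inner_eq_tsum]
    exact tsum_congr fun n => hs n _ _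

theorem IsDirectSum.isSelfAdjoint (hT : IsDirectSum T S) (hS : ∀ n, IsSelfAdjoint (S n)) :
    IsSelfAdjoint T := by
  rw [ContinuousLinearMap.isSelfAdjoint_iff_isSymmetric]
  intro x y
  simp only [ContinuousLinearMap.coe_coe, lp.inner_eq_tsum]
  refine tsum_congr fun n => ?_
  rw [hT, hT]
  exact ContinuousLinearMap.isSelfAdjoint_iff_isSymmetric.1 (hS n) _ _

/-- For an arbitrary basis `e`, self-adjointness moves `S n` onto the block basis vectors. Bessel's
inequality for `e` then bounds each block by its own Hilbert–Schmidt sum. -/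
theorem IsDirectSum.isHilbertSchmidt (hT : IsDirectSum T S) (hS : ∀ n, IsSelfAdjoint (S n))
    {ι : ℕ → Type*} [∀ n, Fintype (ι n)] (b : ∀ n, OrthonormalBasis (ι n) ℂ (G n))
    (hsum : Summable fun n => ∑ i, ‖S n (b n i)‖ ^ 2) : IsHilbertSchmidt T := by
  intro s e
  refine summable_of_sum_le (c := ∑' n, ∑ i, ‖S n (b n i)‖ ^ 2) (fun _ => sq_nonneg _) fun F => ?_
  have h1 : ∀ i, HasSum (fun n => ‖S n ((e i : HilbertSum G) n)‖ ^ 2) (‖T (e i)‖ ^ 2) := by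
    intro i
    have h := lp.hasSum_inner (𝕜 := ℂ) (T (e i)) (T (e i))
    simp only [inner_self_eq_norm_sq_to_K, hT (e i)] at h
    exact_mod_cast h
  refine hasSum_le (fun n => ?_) (hasSum_sum fun i _ => h1 i) hsum.hasSum
  have h2 : ∀ i, ‖S n ((e i : HilbertSum G) n)‖ ^ 2 =
      ∑ k, ‖inner ℂ (e i : HilbertSum G) (lp.single 2 n (S n (b n k)) : HilbertSum G)‖ ^ 2 := by
    intro i
    rw [← (b n).sum_sq_norm_inner_left]
    refine Finset.sum_congr rfl fun k _ => ?_
    rw [lp.inner_single_right]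
    congr 2
    exact ContinuousLinearMap.isSelfAdjoint_iff_isSymmetric.1 (hS n) _ _
  simp only [h2]
  rw [Finset.sum_comm]
  refine Finset.sum_le_sum fun k _ => ?_
  refine (e.orthonormal.sum_inner_products_le _).trans_eq ?_
  rw [lp.norm_single (by norm_num)]

/-- `R` is the difference, and `|R|` the sum, of the positive and negative parts, both with
nonnegative quadratic forms. -/
theorem norm_inner_le_re_inner_abs {E : Type*} [NormedAddCommGroup E] [InnerProductSpace ℂ E]
    [CompleteSpace E] {R : E →L[ℂ] E} (hR : IsSelfAdjoint R) (x : E) :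
    ‖inner ℂ x (R x)‖ ≤ (inner ℂ x (CFC.abs R x)).re := by
  have hpos : ∀ P : E →L[ℂ] E, 0 ≤ P → 0 ≤ (inner ℂ x (P x)).re := fun P hP =>
    ((ContinuousLinearMap.nonneg_iff_isPositive P).1 hP).re_inner_nonneg_right x
  have h1 := hpos _ (CFC.negPart_nonneg R)
  have h2 := hpos _ (CFC.posPart_nonneg R)
  have e1 := CFC.posPart_add_negPart R
  have e2 := CFC.posPart_sub_negPart R
  have him : (inner ℂ x (R x)).im = 0 :=
    (ContinuousLinearMap.isSelfAdjoint_iff_isSymmetric.1 hR).im_inner_self_apply x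
  have hre : inner ℂ x (R x) = ((inner ℂ x (R x)).re : ℂ) := Complex.ext rfl (by simpa using him)
  have h3 := congrArg (fun P : E →L[ℂ] E => (inner ℂ x (P x)).re) e1
  have h4 := congrArg (fun P : E →L[ℂ] E => (inner ℂ x (P x)).re) e2
  simp only [add_apply, sub_apply, inner_add_right, inner_sub_right, Complex.add_re,
    Complex.sub_re] at h3 h4
  rw [hre, Complex.norm_real, Real.norm_eq_abs, abs_le]
  constructor <;> linarith

theorem IsDirectSum.not_isTraceClass (hT : IsDirectSum T S) (hS : ∀ n, IsSelfAdjoint (S n))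
    {m : ℕ → ℕ} {u : ∀ n, Fin (m n) → G n} (hu : ∀ n, Orthonormal ℂ (u n))
    (h : ∀ n, 1 ≤ ∑ k, ‖inner ℂ (u n k) (S n (u n k))‖) : ¬ IsTraceClass T := by
  intro htr
  let U : (Σ n, Fin (m n)) → HilbertSum G := fun p => lp.single 2 p.1 (u p.1 p.2)
  have hU : Orthonormal ℂ U := by
    refine ⟨fun p => ?_, fun p q hpq => ?_⟩
    · simp only [U]
      rw [lp.norm_single (by norm_num)]
      exact (hu p.1).1 p.2
    · obtain ⟨n, k⟩ := p
      obtain ⟨n', k'⟩ := q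
      simp only [U]
      rw [lp.inner_single_left]
      rcases eq_or_ne n n' with rfl | hn
      · rw [lp.single_apply_self]
        exact (hu n).2 fun hk => hpq (by rw [hk])
      · rw [lp.single_apply_ne _ _ _ hn, inner_zero_right]
  -- The block test vectors together are only orthonormal; trace class is tested on Hilbert bases,
  -- so they are completed to one.
  obtain ⟨w, e, hw, he⟩ := hU.toSubtypeRange.exists_hilbertBasis_extension
  have h1 := htr w e
  let g : (Σ n, Fin (m n)) → w := fun p => ⟨U p, hw ⟨p, rfl⟩⟩
  have hg : Function.Injective g := fun p q hpq =>
    hU.linearIndependent.injective (congrArg Subtype.val hpq)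
  have h2 := h1.comp_injective hg
  have hge : ∀ p, e (g p) = U p := fun p => by rw [he]
  have h3 : Summable fun p : Σ n, Fin (m n) => ‖inner ℂ (u p.1 p.2) (S p.1 (u p.1 p.2))‖ := by
    refine Summable.of_nonneg_of_le (fun _ => norm_nonneg _) (fun p => ?_) h2
    simp only [Function.comp_apply, hge]
    refine le_trans (le_of_eq ?_) (norm_inner_le_re_inner_abs (hT.isSelfAdjoint hS) (U p))
    simp only [U]
    rw [hT.apply_single, lp.inner_single_left, lp.single_apply_self]
  have h4 := h3.sigma
  simp only [tsum_fintype] at h4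
  -- Summability would force the block sums to tend to `0`, but each is at least `1`.
  have h5 := h4.tendsto_atTop_zero.eventually_lt_const one_pos
  obtain ⟨n, hn⟩ := h5.exists
  exact absurd (h n) (not_le.2 hn)

end DirectSum

/-! ### Gluing the blocks and the final assembly -/

theorem norm_le_sqrt_sum_norm_sq {V ι : Type*} [NormedAddCommGroup V] [InnerProductSpace ℂ V]
    [CompleteSpace V] [Fintype ι] (b : OrthonormalBasis ι ℂ V) {T : V →L[ℂ] V}
    (hT : IsSelfAdjoint T) : ‖T‖ ≤ √(∑ i, ‖T (b i)‖ ^ 2) := by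
  refine T.opNorm_le_bound (Real.sqrt_nonneg _) fun x => ?_
  rw [← Real.sqrt_sq (norm_nonneg x), ← Real.sqrt_mul (Finset.sum_nonneg fun _ _ => sq_nonneg _)]
  refine Real.le_sqrt_of_sq_le ?_
  rw [← b.sum_sq_norm_inner_right, Finset.sum_mul]
  refine Finset.sum_le_sum fun i _ => ?_
  have h : inner ℂ (b i) (T x) = inner ℂ (T (b i)) x :=
    (ContinuousLinearMap.isSelfAdjoint_iff_isSymmetric.1 hT _ _).symm
  rw [h, ← mul_pow]
  exact pow_le_pow_left₀ (norm_nonneg _) (norm_inner_le_norm _ _) 2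

theorem IsDirectSum.exists_isHilbertSchmidt {G : ℕ → Type*} [∀ n, NormedAddCommGroup (G n)]
    [∀ n, InnerProductSpace ℂ (G n)] [∀ n, CompleteSpace (G n)] {S : ∀ n, G n →L[ℂ] G n}
    (hS : ∀ n, IsSelfAdjoint (S n)) {ι : ℕ → Type*} [∀ n, Fintype (ι n)]
    (b : ∀ n, OrthonormalBasis (ι n) ℂ (G n)) {c : ℕ → ℝ} (hc : Summable c)
    (hle : ∀ n, ∑ i, ‖S n (b n i)‖ ^ 2 ≤ c n) :
    ∃ T : HilbertSum G →L[ℂ] HilbertSum G,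
      IsDirectSum T S ∧ IsSelfAdjoint T ∧ IsHilbertSchmidt T := by
  have h0 : ∀ n, 0 ≤ ∑ i, ‖S n (b n i)‖ ^ 2 := fun n => Finset.sum_nonneg fun _ _ => sq_nonneg _
  have hsum := Summable.of_nonneg_of_le h0 hle hc
  obtain ⟨T, hT⟩ := exists_isDirectSum (S := S) (C := √(∑' n, ∑ i, ‖S n (b n i)‖ ^ 2)) fun n =>
    (norm_le_sqrt_sum_norm_sq (b n) (hS n)).trans
      (Real.sqrt_le_sqrt (hsum.le_tsum n fun k _ => h0 k))
  exact ⟨T, hT, hT.isSelfAdjoint hS, hT.isHilbertSchmidt hS b hsum⟩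

/-- One function of class `C²` with bounded second derivative that agrees, up to affine functions,
with given rescaled polynomials on a sequence of disjoint intervals tending to infinity. -/
theorem exists_function_of_blocks {q : ℕ → Polynomial ℝ} {M r : ℕ → ℝ} (hM : ∀ j, 0 ≤ M j)
    (hr : ∀ j, 0 < r j)
    (hq : ∀ j, ∀ x ∈ Icc (-M j) (M j), |(q j).derivative.derivative.eval x| ≤ 3) :
    ∃ (f : ℝ → ℝ) (c : ℕ → ℝ), ContDiff ℝ 2 f ∧ (∀ x, |iteratedDeriv 2 f x| ≤ 3) ∧
      (∀ j : ℕ, (j : ℝ) + r j * M j ≤ c j) ∧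
      ∀ j, ∃ α β : ℝ, ∀ x ∈ Icc (-M j) (M j),
        f (c j + r j * x) = r j ^ 2 * (q j).eval x + α + β * x := by
  have hrM : ∀ j, 0 ≤ r j * M j := fun j => mul_nonneg (hr j).le (hM j)
  -- Left endpoints of consecutive intervals of length `2 * (r i * M i)` separated by gaps of length
  -- `1`; the term `j` gives `c j - r j * M j ≥ j`.
  let l : ℕ → ℝ := fun j => j + ∑ i ∈ Finset.range j, 2 * (r i * M i)
  let c : ℕ → ℝ := fun j => l j + r j * M j
  have hscale : ∀ j, ∀ x ∈ Icc (l j) (l j + 2 * (r j * M j)), (x - c j) / r j ∈ Icc (-M j) (M j) := by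
    intro j x hx
    constructor
    · rw [le_div_iff₀ (hr j)]
      simp only [c]
      linarith [hx.1]
    · rw [div_le_iff₀ (hr j)]
      simp only [c]
      linarith [hx.2]
  obtain ⟨h, hh, hb, heq⟩ := exists_continuous_eqOn_Icc (l := l)
    (u := fun j => l j + 2 * (r j * M j))
    (g := fun j x => (q j).derivative.derivative.eval ((x - c j) / r j)) (C := 3) (by norm_num)
    (fun j => by linarith [hrM j])
    (fun j => by
      simp only [l]
      rw [Finset.sum_range_succ]
      push_cast
      linarith)
    (fun j => (q j).derivative.derivative.continuous.comp (by fun_prop))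
    (fun j x hx => hq j _ (hscale j x hx))
  obtain ⟨f, f', hf, hf2, hd, hd'⟩ := exists_contDiff_two_hasDerivAt hh
  refine ⟨f, c, hf, by rwa [hf2], fun j => ?_, fun j =>
    exists_eq_polynomial_add_affine hd hd' (q j) fun x hx => ?_⟩
  · have : 0 ≤ ∑ i ∈ Finset.range j, 2 * (r i * M i) :=
      Finset.sum_nonneg fun i _ => by linarith [hrM i]
    simp only [c, l]
    linarith
  · rw [heq j]
    · congr 1
      have := (hr j).ne'
      field_simp
      ring
    · have h1 := mul_le_mul_of_nonneg_left hx.1 (hr j).le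
      have h2 := mul_le_mul_of_nonneg_left hx.2 (hr j).le
      simp only [c]
      constructor <;> linarith

theorem mul_norm_le_norm_smul_one_add {V : Type*} [NormedAddCommGroup V] [InnerProductSpace ℂ V]
    {A : V →L[ℂ] V} {c r M k : ℝ} (hr : 0 ≤ r) (hA : ‖A‖ ≤ M) (hk : 0 ≤ k) (hc : k + r * M ≤ c)
    (x : V) : k * ‖x‖ ≤ ‖((c : ℂ) • (1 : V →L[ℂ] V) + (r : ℂ) • A) x‖ := by
  have hM : 0 ≤ M := (norm_nonneg A).trans hA
  have hc0 : 0 ≤ c := by linarith [mul_nonneg hr hM]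
  have h1 : ‖(r : ℂ) • A x‖ ≤ r * M * ‖x‖ := by
    rw [norm_smul, Complex.norm_real, Real.norm_of_nonneg hr, mul_assoc]
    exact mul_le_mul_of_nonneg_left (A.le_of_opNorm_le hA x) hr
  have h2 : ‖(c : ℂ) • x‖ = c * ‖x‖ := by
    rw [norm_smul, Complex.norm_real, Real.norm_of_nonneg hc0]
  have h3 : ((c : ℂ) • (1 : V →L[ℂ] V) + (r : ℂ) • A) x = (c : ℂ) • x + (r : ℂ) • A x := rfl
  have h4 := norm_sub_norm_le ((c : ℂ) • x) (-((r : ℂ) • A x))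
  rw [sub_neg_eq_add, norm_neg, h2] at h4
  rw [h3]
  nlinarith [mul_le_mul_of_nonneg_right hc (norm_nonneg x)]

theorem mainTheorem4 :
    ∃ (f : ℝ → ℝ) (d : ℕ → ℕ)
      (A B : ∀ n, EuclideanSpace ℂ (Fin (d n)) →L[ℂ] EuclideanSpace ℂ (Fin (d n))),
      ContDiff ℝ 2 f ∧ (∃ C : ℝ, ∀ x, |iteratedDeriv 2 f x| ≤ C) ∧
      (∀ n, IsSelfAdjoint (A n)) ∧ (∀ n, IsSelfAdjoint (B n)) ∧
      IsSelfAdjoint (directSumOp A) ∧ ¬ IsBoundedOp (directSumOp A) ∧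
      (∃ T : HilbertSum (fun n => EuclideanSpace ℂ (Fin (d n))) →L[ℂ]
          HilbertSum (fun n => EuclideanSpace ℂ (Fin (d n))),
        IsDirectSum T B ∧ IsSelfAdjoint T ∧ IsHilbertSchmidt T) ∧
      (∀ n, DifferentiableAt ℝ (fun t : ℝ => cfc f (A n + (t : ℂ) • B n)) 0) ∧
      (∃ R : HilbertSum (fun n => EuclideanSpace ℂ (Fin (d n))) →L[ℂ]
          HilbertSum (fun n => EuclideanSpace ℂ (Fin (d n))),
        IsDirectSum R (fun n => taylorRemainder f (A n) (B n)) ∧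
        IsHilbertSchmidt R ∧ ¬ IsTraceClass R) := by
  -- The bound `2 ^ j` is chosen to offset the factor `2⁻ʲ` that the scaling below puts on the
  -- remainder.
  choose d n m b X hX u hu hX5 hXu using fun j : ℕ => exists_block (2 ^ j)
  choose A B D q M τ hA hB hAB hq hτ hBs hD hR using hX
  have hM : ∀ j, 0 ≤ M j := fun j => by linarith [hAB j, norm_nonneg (A j), norm_nonneg (B j)]
  -- Chosen so that `r j ^ 2 * τ j = 2⁻ʲ`. The scaled increment then has squared Hilbert–Schmidt
  -- norm at most `2 * 2⁻ʲ`, and the remainder is exactly `2⁻ʲ X j`.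
  let r : ℕ → ℝ := fun j => √((1 / 2) ^ j / τ j)
  have hr : ∀ j, 0 < r j := fun j => Real.sqrt_pos.2 (div_pos (by positivity) (hτ j))
  have hrτ : ∀ j, r j ^ 2 * τ j = (1 / 2) ^ j := fun j => by
    rw [Real.sq_sqrt (div_pos (by positivity) (hτ j)).le, div_mul_cancel₀ _ (hτ j).ne']
  obtain ⟨f, c, hf, hf2, hc, hfq⟩ := exists_function_of_blocks hM hr hq
  choose α β hfq using hfq
  let A' := fun j => ((c j : ℂ) • (1 : EuclideanSpace ℂ (Fin (d j)) →L[ℂ] _) + (r j : ℂ) • A j)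
  let B' := fun j => (r j : ℂ) • B j
  have hsa : ∀ (t : ℝ) j (Y : EuclideanSpace ℂ (Fin (d j)) →L[ℂ] EuclideanSpace ℂ (Fin (d j))),
      IsSelfAdjoint Y → IsSelfAdjoint ((t : ℂ) • Y) := fun t j Y hY => by
    rw [IsSelfAdjoint, star_smul, hY.star_eq]
    simp
  have hA' : ∀ j, IsSelfAdjoint (A' j) := fun j =>
    (hsa _ j _ (IsSelfAdjoint.one _)).add (hsa _ j _ (hA j))
  have hB' : ∀ j, IsSelfAdjoint (B' j) := fun j => hsa _ j _ (hB j)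
  have hrem : ∀ j, taylorRemainder f (A' j) (B' j) = (((1 / 2) ^ j : ℝ) : ℂ) • X j := by
    intro j
    rw [taylorRemainder_of_eq_polynomial hf.continuous (hfq j) (hA j) (hB j) (hAB j) (hD j), hR j,
      smul_smul, hrτ, Complex.coe_smul]
  have hremsa : ∀ j, IsSelfAdjoint (taylorRemainder f (A' j) (B' j)) := fun j =>
    isSelfAdjoint_taylorRemainder f _ _
  have hgeom : ∀ j, (0 : ℝ) ≤ (1 / 2) ^ j := fun j => by positivity
  obtain ⟨R, hRd, hRsa, hRhs⟩ := IsDirectSum.exists_isHilbertSchmidt hremsa b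
    (c := fun j => 5 * (1 / 4) ^ j)
    ((summable_geometric_of_lt_one (by norm_num) (by norm_num)).mul_left 5) fun j => by
      simp only [hrem, smul_apply, norm_smul, mul_pow, ← Finset.mul_sum, Complex.norm_real]
      rw [Real.norm_of_nonneg (hgeom j), ← pow_mul, mul_comm j, pow_mul, mul_comm,
        show ((1 : ℝ) / 2) ^ 2 = 1 / 4 by norm_num]
      exact mul_le_mul_of_nonneg_right (hX5 j).le (by positivity)
  have hnt : ∀ j, Nontrivial (EuclideanSpace ℂ (Fin (d j))) := fun j =>
    ⟨⟨b j none, 0, (b j).orthonormal.ne_zero none⟩⟩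
  refine ⟨f, d, A', B', hf, ⟨3, hf2⟩, hA', hB', isSelfAdjoint_directSumOp hA',
    not_isBoundedOp_directSumOp hnt fun j x => ?_, ?_, fun j => ?_, R, hRd, hRhs, ?_⟩
  · exact mul_norm_le_norm_smul_one_add (hr j).le
      (by linarith [hAB j, norm_nonneg (B j)]) (Nat.cast_nonneg j) (hc j) x
  · refine IsDirectSum.exists_isHilbertSchmidt hB' b (c := fun j => 2 * (1 / 2) ^ j)
      ((summable_geometric_of_lt_one (by norm_num) (by norm_num)).mul_left 2) fun j => ?_
    simp only [B', smul_apply, norm_smul, mul_pow, ← Finset.mul_sum, Complex.norm_real]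
    rw [Real.norm_of_nonneg (hr j).le, ← hrτ]
    nlinarith [mul_le_mul_of_nonneg_left (hBs j) (sq_nonneg (r j))]
  · exact (hasDerivAt_cfc_of_eq_polynomial hf.continuous (hfq j) (hA j) (hB j) (hAB j)
      (hD j)).differentiableAt
  · refine hRd.not_isTraceClass hremsa hu fun j => ?_
    simp only [hrem, smul_apply, inner_smul_right, norm_mul, Complex.norm_real, ← Finset.mul_sum]
    rw [Real.norm_of_nonneg (hgeom j)]
    calc (1 : ℝ) = (1 / 2) ^ j * 2 ^ j := by rw [← mul_pow]; norm_num
      _ ≤ _ := mul_le_mul_of_nonneg_left (hXu j).le (hgeom j)
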